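/- Let $n\ge 1$ be an integer. For $\alpha>n/2$ let $\mathfrak m_{n,\alpha}$ denote the Cauchy measure of order $\alpha$ on Euclidean space $\mathbb R^n$, that is, the Borel probability measure with density $\frac1{c_{n,\alpha}}(1+|x|^2)^{-\alpha}$ with respect to Lebesgue measure, where $c_{n,\alpha}=\int_{\mathbb R^n}(1+|x|^2)^{-\alpha}\,dx$. For a Borel probability measure $\nu$ on $\mathbb R^n$ and a Borel set $A\subset\mathbb R^n$, let $$\nu^+(A)=\liminf_{\varepsilon\downarrow 0}\frac{\nu(A_\varepsilon)-\nu(A)}{\varepsilon}\in[0,\infty]$$ be the $\nu$-perimeter (outer Minkowski content) of $A$, where $A_\varepsilon$ is the open Euclidean $\varepsilon$-neighborhood of $A$. Let $\beta\ge\frac{n+1}{2}$, $\beta^*=\beta+\frac{n+1}{2}$, and $$d=\frac{\Gamma(\beta^*-\frac n2)^2}{\Gamma(\beta^*-n)\,\Gamma(\beta^*)},\qquad c=\frac{d}{\sqrt\pi}\sqrt{2\beta}.$$ Then for every Borel set $A\subset\mathbb R^n$, $$\mathfrak m_{n,\beta}^+(A)\ \ge\ c\,\mathfrak m_{n,\beta^*}(A)\,\bigl(1-\mathfrak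 m_{n,\beta^*}(A)\bigr).$$ Moreover, if $\beta\ge n^2$, then $c\ge\frac{1}{\sqrt{2\pi}}\sqrt\beta$. -/

import Mathlib

open MeasureTheory Filter Topology

noncomputable section

/-- The normalizing constant `∫ (1 + |x|²)^(-α) dx` over `ℝⁿ`; it is finite exactly when
`α > n / 2`, the standing assumption on the order of a Cauchy measure. -/
def cauchyNorm (n : ℕ) (α : ℝ) : ℝ :=
  ∫ x : EuclideanSpace ℝ (Fin n), (1 + ‖x‖ ^ 2) ^ (-α)

/-- The `n`-dimensional Cauchy measure of order `α > n / 2`: the probability measure on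
Euclidean `ℝⁿ` with Lebesgue density proportional to `(1 + |x|²)^(-α)`. -/
def cauchyMeasure (n : ℕ) (α : ℝ) : Measure (EuclideanSpace ℝ (Fin n)) :=
  volume.withDensity fun x => ENNReal.ofReal ((1 / cauchyNorm n α) * (1 + ‖x‖ ^ 2) ^ (-α))

/-- The `ν`-perimeter (outer Minkowski content) of `A`, with values in `[0, ∞]`:
`liminf (ν(A_ε) - ν(A)) / ε` as `ε ↓ 0`, where `A_ε = Metric.thickening ε A` is the open
`ε`-neighbourhood of `A`. -/
def outerPerimeter {n : ℕ} (ν : Measure (EuclideanSpace ℝ (Fin n)))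
    (A : Set (EuclideanSpace ℝ (Fin n))) : ENNReal :=
  liminf (fun ε : ℝ => (ν (Metric.thickening ε A) - ν A) / ENNReal.ofReal ε) (𝓝[>] 0)

/-- The constant `d_{n,α} = Γ(α - n/2)² / (Γ(α - n) Γ(α))`, for `α > n`. -/
def cauchyD (n : ℕ) (α : ℝ) : ℝ :=
  Real.Gamma (α - n / 2) ^ 2 / (Real.Gamma (α - n) * Real.Gamma α)

/-- The normalization is correct: `cauchyMeasure n α` is a probability measure for `α > n / 2`. -/
theorem isProbabilityMeasure_cauchyMeasure (n : ℕ) (α : ℝ) (hα : (n : ℝ) / 2 < α) :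
    IsProbabilityMeasure (cauchyMeasure n α) := by
  have hint : Integrable (fun x : EuclideanSpace ℝ (Fin n) => (1 + ‖x‖ ^ 2) ^ (-α)) := by
    have h := integrable_rpow_neg_one_add_norm_sq (E := EuclideanSpace ℝ (Fin n))
      (μ := volume) (r := 2 * α) (by rw [finrank_euclideanSpace_fin]; linarith)
    convert h using 3
    ring
  have hpos : 0 < cauchyNorm n α := by
    refine (integral_pos_iff_support_of_nonneg (fun x => by positivity) hint).2 ?_
    have : Function.support (fun x : EuclideanSpace ℝ (Fin n) => (1 + ‖x‖ ^ 2) ^ (-α))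
        = Set.univ := by
      ext x
      have : 0 < (1 + ‖x‖ ^ 2) ^ (-α) := by positivity
      simpa using this.ne'
    rw [this]
    exact Measure.measure_univ_pos.2 (NeZero.ne _)
  constructor
  rw [cauchyMeasure, withDensity_apply _ MeasurableSet.univ, Measure.restrict_univ,
    ← ofReal_integral_eq_lintegral_ofReal (hint.const_mul _)
      (Eventually.of_forall fun x => by positivity), integral_const_mul]
  change ENNReal.ofReal (1 / cauchyNorm n α * cauchyNorm n α) = 1
  rw [one_div_mul_cancel hpos.ne', ENNReal.ofReal_one]

end

/-! Write `β = b + n/2` with `b ≥ 1/2`, so that `β* = b + n + 1/2`; call this order `α`. The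
inequality comes from a rotation argument of the kind used for Gaussian measures. For a smooth `g`,
join `x` to `y` by the quarter circle `cos θ x + sin θ y` and bound `|g x - g y|` by the integral of
the gradient along it. Weight by `((1+|x|²)(1+|y|²))^(-α)` and integrate over pairs. The rotation
`(x, y) ↦ (z, v)` to position and velocity preserves Lebesgue measure, so the oscillation of `g` is
at most an integral over `z` of the fibre integral of `|Dg(z) v|` against the rotated weight
averaged over `θ` (`lintegral_oscillation_le`).

The Cauchy weight is not rotation invariant, but `(1+|x|²)(1+|y|²) ≥ 1 + |z|² + |v|²`. Integrating
`|L v| (1+|z|²+|v|²)^(-α)` over `v` leaves a multiple of `‖L‖ (1+|z|²)^(-(α-(n+1)/2))`, which is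
exactly the weight of order `β`. This accounts for the shift between `β` and `β*`.

The crude bound gives the required constant for `n = 1`. For `n ≥ 2` a factor `J` is gained from the
discarded term `|x|²|y|²`: its oscillation in `θ` is averaged by an explicit trigonometric integral,
and a concavity argument in `v` makes the gain uniform in `z` (`exists_fibre_constant`). What
remains to compare constants is `(b + n/2) J² ≤ 8 (Γ(b+1/2)/Γ(b))²`, which follows from rational
bounds on Gamma quotients.

Applying the functional inequality to a smooth cutoff between `A` and the complement of its
`ε`-neighbourhood gives a bound at each scale, and then `ε` tends to `0`. The final claim is `d ≥
1/2`: `d²` is a product of `n` quotients of squared Gamma quotients, each close to `1` when `β ≥ n²`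
(`half_le_cauchyD`). -/

noncomputable section

/-! ### Bounds for Gamma quotients with half-integer shift -/

/-- The squared Gamma quotient `(Γ(x + 1/2) / Γ(x))²`. -/
def gammaQuotSq (x : ℝ) : ℝ := (Real.Gamma (x + 1 / 2) / Real.Gamma x) ^ 2

theorem gammaQuotSq_pos {x : ℝ} (hx : 0 < x) : 0 < gammaQuotSq x := by
  have h1 := Real.Gamma_pos_of_pos hx
  have h2 : 0 < Real.Gamma (x + 1 / 2) := Real.Gamma_pos_of_pos (by linarith)
  unfold gammaQuotSq
  positivity

/-- Log-convexity of Gamma at the midpoint of `x` and `x + 1`. -/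
theorem gammaQuotSq_le {x : ℝ} (hx : 0 < x) : gammaQuotSq x ≤ x := by
  have h1 := Real.Gamma_pos_of_pos hx
  have h2 : 0 < Real.Gamma (x + 1) := Real.Gamma_pos_of_pos (by linarith)
  have h := Real.Gamma_mul_add_mul_le_rpow_Gamma_mul_rpow_Gamma hx (show 0 < x + 1 by linarith)
    (show (0 : ℝ) < 1 / 2 by norm_num) (show (0 : ℝ) < 1 / 2 by norm_num) (by norm_num)
  rw [show 1 / 2 * x + 1 / 2 * (x + 1) = x + 1 / 2 by ring, ← Real.sqrt_eq_rpow,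
    ← Real.sqrt_eq_rpow] at h
  have h3 : 0 < Real.Gamma (x + 1 / 2) := Real.Gamma_pos_of_pos (by linarith)
  have h4 : Real.Gamma (x + 1 / 2) ^ 2 ≤ Real.Gamma x * Real.Gamma (x + 1) := by
    calc Real.Gamma (x + 1 / 2) ^ 2 ≤ (√(Real.Gamma x) * √(Real.Gamma (x + 1))) ^ 2 := by gcongr
      _ = _ := by rw [mul_pow, Real.sq_sqrt h1.le, Real.sq_sqrt h2.le]
  rw [Real.Gamma_add_one hx.ne'] at h4
  unfold gammaQuotSq
  rw [div_pow, div_le_iff₀ (by positivity)]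
  linarith [h4]

theorem gammaQuotSq_mul_shift {x : ℝ} (hx : 0 < x) :
    gammaQuotSq x * gammaQuotSq (x + 1 / 2) = x ^ 2 := by
  have h1 := Real.Gamma_pos_of_pos hx
  have h3 : 0 < Real.Gamma (x + 1 / 2) := Real.Gamma_pos_of_pos (by linarith)
  unfold gammaQuotSq
  rw [show x + 1 / 2 + 1 / 2 = x + 1 by ring, Real.Gamma_add_one hx.ne']
  field_simp

theorem gammaQuotSq_add_one {x : ℝ} (hx : 0 < x) :
    gammaQuotSq (x + 1) = gammaQuotSq x * ((x + 1 / 2) / x) ^ 2 := by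
  have h1 := gammaQuotSq_mul_shift hx
  have h2 := gammaQuotSq_mul_shift (show 0 < x + 1 / 2 by linarith)
  have h3 := gammaQuotSq_pos (show 0 < x + 1 / 2 by linarith)
  rw [show x + 1 / 2 + 1 / 2 = x + 1 by ring] at h2
  have h4 : gammaQuotSq (x + 1 / 2) * gammaQuotSq (x + 1) * x ^ 2
      = gammaQuotSq x * gammaQuotSq (x + 1 / 2) * (x + 1 / 2) ^ 2 := by rw [h1, h2]; ring
  rw [div_pow, ← mul_div_assoc, eq_div_iff (by positivity)]
  apply mul_left_cancel₀ h3.ne'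
  linarith

/-- The upper bound at `x - 1/2` turns into a lower bound at `x`, because the product of the two
quotients is `(x - 1/2)²`. -/
theorem sub_half_le_gammaQuotSq {x : ℝ} (hx : 1 / 2 < x) : x - 1 / 2 ≤ gammaQuotSq x := by
  have h0 : 0 < x - 1 / 2 := by linarith
  have h1 := gammaQuotSq_mul_shift h0
  have h2 := gammaQuotSq_le h0
  rw [show x - 1 / 2 + 1 / 2 = x by ring] at h1
  have h3 := gammaQuotSq_pos (show 0 < x by linarith)
  nlinarith

/-- The upper Watson bound `(Γ(x + 1/2) / Γ(x))² ≤ x² / (x + 1/4)`. -/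
theorem gammaQuotSq_le_watson {x : ℝ} (hx : 0 < x) : gammaQuotSq x ≤ x ^ 2 / (x + 1 / 4) := by
  -- The ratio of the two sides increases under `y ↦ y + 1` and has upper limit at most `1`. The
  -- shift `1/4` makes the two cubics in the monotonicity step agree up to a constant `1/16`.
  set s : ℝ → ℝ := fun y => gammaQuotSq y * (y + 1 / 4) / y ^ 2 with hs
  have hstep : ∀ y : ℝ, 0 < y → s y ≤ s (y + 1) := by
    intro y hy
    have hq := gammaQuotSq_pos hy
    simp only [hs]
    rw [gammaQuotSq_add_one hy, div_le_div_iff₀ (by positivity) (by positivity)]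
    have : gammaQuotSq y * ((y + 1 / 2) / y) ^ 2 * (y + 1 + 1 / 4) * y ^ 2
        = gammaQuotSq y * ((y + 1 / 2) ^ 2 * (y + 1 + 1 / 4)) := by field_simp
    rw [this, mul_assoc]
    apply mul_le_mul_of_nonneg_left _ hq.le
    nlinarith
  have hmono : ∀ k : ℕ, s x ≤ s (x + k) := by
    intro k
    induction k with
    | zero => simp
    | succ k ih =>
      refine ih.trans ((hstep (x + k) (by positivity)).trans_eq ?_)
      push_cast; ring_nf
  have hup : ∀ k : ℕ, s x ≤ 1 + 1 / 4 / (x + k) := by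
    intro k
    have hpos : 0 < x + k := by positivity
    refine (hmono k).trans ?_
    have h1 := gammaQuotSq_le hpos
    simp only [hs]
    rw [div_le_iff₀ (by positivity)]
    calc _ ≤ (x + k) * (x + k + 1 / 4) := by gcongr
      _ = _ := by field_simp
  have hlim : Tendsto (fun k : ℕ => 1 + 1 / 4 / (x + (k : ℝ))) atTop (𝓝 (1 + 0)) := by
    refine tendsto_const_nhds.add (tendsto_const_nhds.div_atTop ?_)
    exact tendsto_atTop_add_const_left _ _ tendsto_natCast_atTop_atTop
  have h := ge_of_tendsto' hlim hup
  simp only [hs, add_zero] at h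
  rw [div_le_iff₀ (by positivity)] at h
  rw [le_div_iff₀ (by positivity)]
  linarith

/-- The upper Watson bound at `x + 3/2` is reflected to `x + 1` by the product identity and carried
back to `x` by the recursion. Reflecting directly from `x + 1/2` would give a weaker bound. -/
theorem le_gammaQuotSq_watson {x : ℝ} (hx : 0 < x) :
    x ^ 2 * (x + 1) ^ 2 * (x + 7 / 4) / ((x + 1 / 2) ^ 2 * (x + 3 / 2) ^ 2) ≤ gammaQuotSq x := by
  have h1 := gammaQuotSq_le_watson (show 0 < x + 3 / 2 by linarith)
  have h2 := gammaQuotSq_mul_shift (show 0 < x + 1 by linarith)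
  rw [show x + 1 + 1 / 2 = x + 3 / 2 by ring] at h2
  have h3 := gammaQuotSq_add_one hx
  have hq := gammaQuotSq_pos hx
  have hq1 := gammaQuotSq_pos (show 0 < x + 1 by linarith)
  rw [show x + 3 / 2 + 1 / 4 = x + 7 / 4 by ring, le_div_iff₀ (by positivity)] at h1
  have h4 : (x + 1) ^ 2 * (x + 7 / 4) ≤ gammaQuotSq (x + 1) * (x + 3 / 2) ^ 2 := by
    rw [← h2, mul_assoc]
    gcongr
  rw [h3] at h4
  have h5 : gammaQuotSq x * ((x + 1 / 2) / x) ^ 2 * (x + 3 / 2) ^ 2 * x ^ 2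
      = gammaQuotSq x * ((x + 1 / 2) ^ 2 * (x + 3 / 2) ^ 2) := by field_simp
  rw [div_le_iff₀ (by positivity), ← h5]
  nlinarith [mul_le_mul_of_nonneg_right h4 (sq_nonneg x)]

/-- A Gamma ratio with half-integer shift as a product of Gamma quotients. -/
theorem sq_Gamma_ratio_eq_prod (n : ℕ) {x : ℝ} (hx : 0 < x) :
    (Real.Gamma (x + n / 2) / Real.Gamma x) ^ 2 =
      ∏ j ∈ Finset.range n, gammaQuotSq (x + j / 2) := by
  induction n with
  | zero =>
    have h1 := Real.Gamma_pos_of_pos hx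
    simp [h1.ne']
  | succ n ih =>
    rw [Finset.prod_range_succ, ← ih, gammaQuotSq, ← mul_pow]
    have h1 : 0 < Real.Gamma (x + n / 2) := Real.Gamma_pos_of_pos (by positivity)
    have h2 := Real.Gamma_pos_of_pos hx
    push_cast
    rw [show x + (n + 1) / 2 = x + (n : ℝ) / 2 + 1 / 2 by ring]
    field_simp

/-! ### The lower bound `d ≥ 1/2` -/

theorem one_sub_le_prod_of_le {n : ℕ} {f : ℕ → ℝ} {t : ℝ} (ht1 : t ≤ 1)
    (hf : ∀ j < n, 1 - t ≤ f j) : 1 - n * t ≤ ∏ j ∈ Finset.range n, f j := by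
  have h1 : (1 - t) ^ n ≤ ∏ j ∈ Finset.range n, f j := by
    rw [← Finset.card_range n, ← Finset.prod_const, Finset.card_range]
    exact Finset.prod_le_prod (fun _ _ => by linarith) fun j hj => hf j (Finset.mem_range.1 hj)
  have h2 := one_add_mul_le_pow (show (-2 : ℝ) ≤ -t by linarith) n
  have h3 : (1 + -t) ^ n = (1 - t) ^ n := by ring
  linarith

theorem half_le_cauchyD {n : ℕ} (hn : 1 ≤ n) {β : ℝ} (hβ : (n : ℝ) ^ 2 ≤ β) :
    1 / 2 ≤ cauchyD n (β + ((n : ℝ) + 1) / 2) := by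
  have hn' : (1 : ℝ) ≤ n := by exact_mod_cast hn
  set x : ℝ := β - n / 2 + 1 / 2 with hxdef
  have hx : 1 / 2 < x := by nlinarith
  have hx0 : 0 < x := by linarith
  have hxn : 0 < x + n / 2 := by positivity
  have g0 := Real.Gamma_pos_of_pos hx0
  have g1 := Real.Gamma_pos_of_pos hxn
  have g2 : 0 < Real.Gamma (x + n / 2 + n / 2) := Real.Gamma_pos_of_pos (by positivity)
  have hd : cauchyD n (β + ((n : ℝ) + 1) / 2) =
      Real.Gamma (x + n / 2) ^ 2 / (Real.Gamma x * Real.Gamma (x + n / 2 + n / 2)) := by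
    unfold cauchyD
    congr 3 <;> · rw [hxdef]; ring_nf
  have hd0 : 0 ≤ cauchyD n (β + ((n : ℝ) + 1) / 2) := by rw [hd]; positivity
  have hsq : cauchyD n (β + ((n : ℝ) + 1) / 2) ^ 2 =
      ∏ j ∈ Finset.range n, gammaQuotSq (x + j / 2) / gammaQuotSq (x + n / 2 + j / 2) := by
    rw [Finset.prod_div_distrib, ← sq_Gamma_ratio_eq_prod n hx0, ← sq_Gamma_ratio_eq_prod n hxn,
      hd]
    field_simp
  -- Since `y - 1/2 ≤ gammaQuotSq y ≤ y`, the `j`-th factor is at least `1 - ((n+1)/2) / (x + n/2 +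
  -- j/2)`; the worst case `j = 0` defines `t`. As `n t ≤ 3/4`, Bernoulli gives `d² ≥ 1/4`.
  set t : ℝ := ((n : ℝ) + 1) / 2 / (x + n / 2) with ht
  have hxv : x + n / 2 = β + 1 / 2 := by rw [hxdef]; ring
  have hnt : (n : ℝ) * t ≤ 3 / 4 := by
    rw [ht, ← mul_div_assoc, div_le_iff₀ hxn, hxv]
    nlinarith [sq_nonneg ((n : ℝ) - 1)]
  have hprod : 1 - n * t ≤
      ∏ j ∈ Finset.range n, gammaQuotSq (x + j / 2) / gammaQuotSq (x + n / 2 + j / 2) := by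
    refine one_sub_le_prod_of_le (by nlinarith) fun j _ => ?_
    have hj : (0 : ℝ) ≤ j / 2 := by positivity
    have a1 := sub_half_le_gammaQuotSq (show 1 / 2 < x + j / 2 by linarith)
    have a2 := gammaQuotSq_le (show 0 < x + n / 2 + j / 2 by linarith)
    have a3 := gammaQuotSq_pos (show 0 < x + n / 2 + j / 2 by linarith)
    rw [le_div_iff₀ a3]
    have a4 : 0 ≤ 1 - t := by nlinarith
    calc (1 - t) * gammaQuotSq (x + n / 2 + j / 2) ≤ (1 - t) * (x + n / 2 + j / 2) := by gcongr
      _ = x + n / 2 + j / 2 - t * (x + n / 2) - t * (j / 2) := by ring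
      _ ≤ x + j / 2 - 1 / 2 := by
        rw [ht, div_mul_cancel₀ _ hxn.ne']
        have : 0 ≤ t * ((j : ℝ) / 2) := by positivity
        rw [ht] at this
        linarith
      _ ≤ _ := a1
  rw [← hsq] at hprod
  nlinarith

/-- The rational inequality behind the comparison of the rotation constant with `c`. -/
theorem rotation_constant_rational {n b : ℝ} (hn : 2 ≤ n) (hb : 1 / 2 ≤ b) :
    16 * (b + n / 2) ^ 3 * (b + n) ^ 2 * ((b + 1 / 2) ^ 2 * (b + 3 / 2) ^ 2) ≤
      8 * (b ^ 2 * (b + 1) ^ 2 * (b + 7 / 4)) *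
        (11 / 20 * (16 * (b + n / 2) ^ 2 * (b + n) ^ 2) +
          13 / 8 * ((b + n + 1 / 2) * (n - 1) ^ 2 * (b + n / 2 + 1 / 4) * (b + n + 1 / 4))) := by
  -- In the variables `x = b - 1/2` and `m = n - 2` the difference of the two sides is a polynomial
  -- with nonnegative coefficients.
  obtain ⟨x, rfl⟩ : ∃ x, b = 1 / 2 + x := ⟨b - 1 / 2, by ring⟩
  obtain ⟨m, rfl⟩ : ∃ m, n = 2 + m := ⟨n - 2, by ring⟩
  have hx : 0 ≤ x := by linarith
  have hm : 0 ≤ m := by linarith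
  rw [← sub_nonneg]
  ring_nf
  positivity

/-! ### The average of `(1 + a sin²)⁻³` over a period -/

theorem one_add_mul_sin_sq_eq (m φ : ℝ) :
    1 + (m ^ 2 - 1) * Real.sin φ ^ 2 = Real.cos φ ^ 2 + m ^ 2 * Real.sin φ ^ 2 := by
  linear_combination -Real.sin_sq_add_cos_sq φ

theorem cos_sq_add_mul_sin_sq_pos {k : ℝ} (hk : 0 < k) (φ : ℝ) :
    0 < Real.cos φ ^ 2 + k * Real.sin φ ^ 2 := by
  have h := Real.sin_sq_add_cos_sq φ
  rcases eq_or_ne (Real.sin φ) 0 with h0 | h0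
  · rw [h0] at h ⊢
    nlinarith
  · positivity

/-- The continuous branch of `arctan (m tan φ)`. -/
def arctanMulTan (m φ : ℝ) : ℝ :=
  φ + Real.arctan ((m - 1) * (Real.sin φ * Real.cos φ) / (Real.cos φ ^ 2 + m * Real.sin φ ^ 2))

theorem hasDerivAt_sin_mul_cos (φ : ℝ) : HasDerivAt (fun φ => Real.sin φ * Real.cos φ)
    (Real.cos φ ^ 2 - Real.sin φ ^ 2) φ := by
  have h := (Real.hasDerivAt_sin φ).mul (Real.hasDerivAt_cos φ)
  exact h.congr_deriv (by ring)

theorem hasDerivAt_cos_sq_add (k φ : ℝ) :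
    HasDerivAt (fun φ => Real.cos φ ^ 2 + k * Real.sin φ ^ 2)
      (2 * (k - 1) * (Real.sin φ * Real.cos φ)) φ := by
  have h := ((Real.hasDerivAt_cos φ).pow 2).add (((Real.hasDerivAt_sin φ).pow 2).const_mul k)
  refine h.congr_deriv ?_
  push_cast
  ring

theorem hasDerivAt_arctanMulTan {m : ℝ} (hm : 0 < m) (φ : ℝ) :
    HasDerivAt (arctanMulTan m) (m / (Real.cos φ ^ 2 + m ^ 2 * Real.sin φ ^ 2)) φ := by
  have hQ := cos_sq_add_mul_sin_sq_pos hm φ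
  have hT := cos_sq_add_mul_sin_sq_pos (pow_pos hm 2) φ
  have h1 := ((hasDerivAt_sin_mul_cos φ).const_mul (m - 1)).div (hasDerivAt_cos_sq_add m φ) hQ.ne'
  have h2 := (hasDerivAt_id φ).add h1.arctan
  refine h2.congr_deriv ?_
  have hsc := Real.sin_sq_add_cos_sq φ
  set s := Real.sin φ
  set c := Real.cos φ
  have hc : c ^ 2 = 1 - s ^ 2 := by linarith
  have key : (c ^ 2 + m * s ^ 2) ^ 2 + ((m - 1) * (s * c)) ^ 2 = c ^ 2 + m ^ 2 * s ^ 2 := by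
    rw [show ((m - 1) * (s * c)) ^ 2 = (m - 1) ^ 2 * s ^ 2 * c ^ 2 by ring, hc]; ring
  have e1 : 1 + ((m - 1) * (s * c) / (c ^ 2 + m * s ^ 2)) ^ 2
      = (c ^ 2 + m ^ 2 * s ^ 2) / (c ^ 2 + m * s ^ 2) ^ 2 := by
    rw [← key]; field_simp
  change 1 + 1 / (1 + ((m - 1) * (s * c) / (c ^ 2 + m * s ^ 2)) ^ 2) * _ = _
  rw [e1]
  have e2 : (m - 1) * (c ^ 2 - s ^ 2) * (c ^ 2 + m * s ^ 2) -
      (m - 1) * (s * c) * (2 * (m - 1) * (s * c)) = (m - 1) * (c ^ 2 - m * s ^ 2) := by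
    rw [show (m - 1) * (s * c) * (2 * (m - 1) * (s * c)) = 2 * (m - 1) ^ 2 * s ^ 2 * c ^ 2 by ring,
      hc]
    ring
  rw [e2]
  field_simp
  linear_combination m * hsc

theorem arctanMulTan_add_pi (m φ : ℝ) :
    arctanMulTan m (φ + Real.pi) = arctanMulTan m φ + Real.pi := by
  unfold arctanMulTan
  rw [Real.sin_add_pi, Real.cos_add_pi]
  ring_nf

/-- An antiderivative of `(cos² + m² sin²)⁻³`. -/
def cubeAntideriv (m φ : ℝ) : ℝ :=
  ((m ^ 2 - 1) * (Real.sin φ * Real.cos φ / (Real.cos φ ^ 2 + m ^ 2 * Real.sin φ ^ 2) ^ 2) +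
    3 * (m ^ 2 + 1) / (2 * m ^ 2) *
      ((m ^ 2 - 1) * (Real.sin φ * Real.cos φ / (Real.cos φ ^ 2 + m ^ 2 * Real.sin φ ^ 2)) +
        (m ^ 2 + 1) * (arctanMulTan m φ / m)) - 2 * (arctanMulTan m φ / m)) / (4 * m ^ 2)

theorem hasDerivAt_cubeAntideriv {m : ℝ} (hm : 0 < m) (φ : ℝ) :
    HasDerivAt (cubeAntideriv m)
      ((Real.cos φ ^ 2 + m ^ 2 * Real.sin φ ^ 2) ^ 3)⁻¹ φ := by
  have hT := cos_sq_add_mul_sin_sq_pos (pow_pos hm 2) φ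
  have hA := (hasDerivAt_arctanMulTan hm φ).div_const m
  have hsc := hasDerivAt_sin_mul_cos φ
  have hd := hasDerivAt_cos_sq_add (m ^ 2) φ
  have h1 := (hsc.div (hd.pow 2) (pow_pos hT 2).ne').const_mul (m ^ 2 - 1)
  have h2 := ((((hsc.div hd hT.ne').const_mul (m ^ 2 - 1)).add (hA.const_mul (m ^ 2 + 1))).const_mul
    (3 * (m ^ 2 + 1) / (2 * m ^ 2)))
  have h3 := ((h1.add h2).sub (hA.const_mul 2)).div_const (4 * m ^ 2)
  refine h3.congr_deriv ?_
  have hs := Real.sin_sq_add_cos_sq φ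
  simp only [Pi.pow_apply]
  set s := Real.sin φ
  set c := Real.cos φ
  obtain ⟨T, hTd⟩ : ∃ T, T = c ^ 2 + m ^ 2 * s ^ 2 := ⟨_, rfl⟩
  rw [← hTd] at hT ⊢
  have hx : (m ^ 2 - 1) * (c ^ 2 - s ^ 2) = m ^ 2 + 1 - 2 * T := by
    rw [hTd]; linear_combination (m ^ 2 + 1) * hs
  have hy : (m ^ 2 - 1) * (2 * (m ^ 2 - 1) * (s * c)) * (s * c) = 2 * ((T - 1) * (m ^ 2 - T)) := by
    have a1 : T - 1 = (m ^ 2 - 1) * s ^ 2 := by rw [hTd]; linear_combination hs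
    have a2 : m ^ 2 - T = (m ^ 2 - 1) * c ^ 2 := by rw [hTd]; linear_combination (-m ^ 2) * hs
    rw [a1, a2]; ring
  have e1 : (m ^ 2 - 1) * (((c ^ 2 - s ^ 2) * T ^ 2 - s * c * (((2 : ℕ) : ℝ) * T ^ (2 - 1) *
      (2 * (m ^ 2 - 1) * (s * c)))) / (T ^ 2) ^ 2)
      = (4 * m ^ 2 - 3 * (m ^ 2 + 1) * T + 2 * T ^ 2) / T ^ 3 := by
    rw [← mul_div_assoc, div_eq_div_iff (by positivity) (by positivity)]
    push_cast
    linear_combination (T ^ 5) * hx - 2 * T ^ 4 * hy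
  have e2 : (m ^ 2 - 1) * (((c ^ 2 - s ^ 2) * T - s * c * (2 * (m ^ 2 - 1) * (s * c))) / T ^ 2)
      = (2 * m ^ 2 - (m ^ 2 + 1) * T) / T ^ 2 := by
    rw [← mul_div_assoc, div_eq_div_iff (by positivity) (by positivity)]
    linear_combination (T ^ 3) * hx - T ^ 2 * hy
  rw [e1, e2]
  field_simp
  ring

theorem cubeAntideriv_add_pi {m : ℝ} (hm : 0 < m) (φ : ℝ) :
    cubeAntideriv m (φ + Real.pi) - cubeAntideriv m φ =
      Real.pi * ((3 * m ^ 4 + 2 * m ^ 2 + 3) / (8 * m ^ 5)) := by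
  unfold cubeAntideriv
  rw [arctanMulTan_add_pi, Real.sin_add_pi, Real.cos_add_pi, neg_mul_neg, neg_sq, neg_sq]
  field_simp
  ring

theorem continuous_inv_one_add_mul_sin_sq_pow {a : ℝ} (ha : 0 ≤ a) (ψ : ℝ) :
    Continuous fun θ : ℝ => ((1 + a * Real.sin (2 * θ + ψ) ^ 2) ^ 3)⁻¹ := by
  refine Continuous.inv₀ (by fun_prop) fun θ => ?_
  positivity

theorem integral_inv_one_add_mul_sin_sq_pow {a : ℝ} (ha : 0 ≤ a) (ψ : ℝ) :
    ∫ θ in (0 : ℝ)..Real.pi / 2, ((1 + a * Real.sin (2 * θ + ψ) ^ 2) ^ 3)⁻¹ =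
      Real.pi / 2 * ((1 + a + 3 * a ^ 2 / 8) / √(1 + a) ^ 5) := by
  set m := √(1 + a) with hmdef
  have hm : 0 < m := Real.sqrt_pos.2 (by linarith)
  have hm2 : m ^ 2 = 1 + a := Real.sq_sqrt (by linarith)
  have ham : a = m ^ 2 - 1 := by linarith
  have hd : ∀ θ : ℝ, HasDerivAt (fun θ => cubeAntideriv m (2 * θ + ψ) / 2)
      ((1 + a * Real.sin (2 * θ + ψ) ^ 2) ^ 3)⁻¹ θ := by
    intro θ
    have h1 : HasDerivAt (fun θ : ℝ => 2 * θ + ψ) 2 θ := by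
      simpa using ((hasDerivAt_id θ).const_mul 2).add_const ψ
    have h2 := ((hasDerivAt_cubeAntideriv hm (2 * θ + ψ)).comp θ h1).div_const 2
    refine h2.congr_deriv ?_
    rw [ham, one_add_mul_sin_sq_eq]
    ring
  rw [intervalIntegral.integral_eq_sub_of_hasDerivAt (fun θ _ => hd θ)
    ((continuous_inv_one_add_mul_sin_sq_pow ha ψ).intervalIntegrable _ _)]
  have h := cubeAntideriv_add_pi hm ψ
  rw [show 2 * (Real.pi / 2) + ψ = ψ + Real.pi by ring, show 2 * (0 : ℝ) + ψ = ψ by ring,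
    ← sub_div, h, ham]
  field_simp
  ring

/-- After squaring, a quintic must dominate another. The coefficients `11/20` and `39/8` make the
two sides nearly touch at `a = 21/40`, so the difference is `(a - 21/40)²` times a polynomial plus a
small remainder, all with positive coefficients. -/
theorem cube_average_le {a : ℝ} (ha : 0 ≤ a) :
    (1 + a + 3 * a ^ 2 / 8) / √(1 + a) ^ 5 ≤ 1 / √(11 / 20 + 39 / 8 * a) := by
  have h1 : 0 < √(1 + a) := Real.sqrt_pos.2 (by linarith)
  have h2 : 0 < √(11 / 20 + 39 / 8 * a) := Real.sqrt_pos.2 (by linarith)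
  rw [div_le_div_iff₀ (by positivity) h2, one_mul]
  apply le_of_sq_le_sq _ (by positivity)
  rw [mul_pow, Real.sq_sqrt (by linarith)]
  have h3 : √(1 + a) ^ 2 = 1 + a := Real.sq_sqrt (by linarith)
  have h4 : (√(1 + a) ^ 5) ^ 2 = (1 + a) ^ 5 := by
    calc _ = (√(1 + a) ^ 2) ^ 5 := by ring
      _ = _ := by rw [h3]
  rw [h4]
  have key : (1 + a) ^ 5 - (1 + a + 3 * a ^ 2 / 8) ^ 2 * (11 / 20 + 39 / 8 * a) =
      (a - 21 / 40) ^ 2 * (13317993/8192000 * a ^ 0 + 433519/163840 * a ^ 1 + 16349/10240 * a ^ 2 + 161/512 * a ^ 3) +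
        (25005087/13107200000 * a ^ 0 + 3561429/1310720000 * a ^ 1) := by
    ring
  rw [← sub_nonneg, key]
  positivity

theorem exists_polar (P Q S : ℝ) (h : P ^ 2 + Q ^ 2 ≤ S ^ 2) :
    ∃ r ψ : ℝ, r ^ 2 ≤ S ^ 2 ∧ ∀ φ, P * Real.cos φ - Q * Real.sin φ = r * Real.cos (φ + ψ) := by
  refine ⟨‖(⟨P, Q⟩ : ℂ)‖, Complex.arg ⟨P, Q⟩, ?_, fun φ => ?_⟩
  · rw [Complex.sq_norm, Complex.normSq_mk]
    linarith
  · have h1 := Complex.norm_mul_cos_arg (⟨P, Q⟩ : ℂ)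
    have h2 := Complex.norm_mul_sin_arg (⟨P, Q⟩ : ℂ)
    simp only at h1 h2
    rw [Real.cos_add]
    linear_combination -Real.cos φ * h1 + Real.sin φ * h2

/-! ### The rotated weight averaged over the angle -/

section Rotation

variable {E : Type*} [NormedAddCommGroup E] [InnerProductSpace ℝ E]

theorem rotate_norm_sq_add (z v : E) (θ : ℝ) :
    ‖Real.cos θ • z - Real.sin θ • v‖ ^ 2 + ‖Real.sin θ • z + Real.cos θ • v‖ ^ 2 =
      ‖z‖ ^ 2 + ‖v‖ ^ 2 := by
  rw [norm_sub_sq_real, norm_add_sq_real]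
  simp only [norm_smul, inner_smul_left, inner_smul_right, mul_pow, Real.norm_eq_abs, sq_abs,
    conj_trivial]
  linear_combination (‖z‖ ^ 2 + ‖v‖ ^ 2) * Real.sin_sq_add_cos_sq θ

theorem rotate_norm_sq_sub (z v : E) (θ : ℝ) :
    ‖Real.cos θ • z - Real.sin θ • v‖ ^ 2 - ‖Real.sin θ • z + Real.cos θ • v‖ ^ 2 =
      (‖z‖ ^ 2 - ‖v‖ ^ 2) * Real.cos (2 * θ) - 2 * inner ℝ z v * Real.sin (2 * θ) := by
  rw [norm_sub_sq_real, norm_add_sq_real, Real.cos_two_mul', Real.sin_two_mul]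
  simp only [norm_smul, inner_smul_left, inner_smul_right, mul_pow, Real.norm_eq_abs, sq_abs,
    conj_trivial]
  ring

/-- The rotated weight is bounded below, up to a phase, by a function of the total energy. -/
theorem exists_phase_le_rotate (z v : E) : ∃ ψ : ℝ, ∀ θ : ℝ,
    (1 + (‖z‖ ^ 2 + ‖v‖ ^ 2)) *
        (1 + (‖z‖ ^ 2 + ‖v‖ ^ 2) ^ 2 / (4 * (1 + (‖z‖ ^ 2 + ‖v‖ ^ 2))) *
          Real.sin (2 * θ + ψ) ^ 2) ≤
      (1 + ‖Real.cos θ • z - Real.sin θ • v‖ ^ 2) *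
        (1 + ‖Real.sin θ • z + Real.cos θ • v‖ ^ 2) := by
  set S := ‖z‖ ^ 2 + ‖v‖ ^ 2 with hSdef
  have hS : 0 ≤ S := by positivity
  -- By Cauchy–Schwarz the amplitude of the oscillation of `X - Y` in `2θ` is at most `S`. Together
  -- with `4XY = S² - (X - Y)²` this gives `XY ≥ S² sin²(2θ + ψ) / 4`.
  have hPQ : (‖z‖ ^ 2 - ‖v‖ ^ 2) ^ 2 + (2 * inner ℝ z v) ^ 2 ≤ S ^ 2 := by
    have h1 := abs_real_inner_le_norm z v
    have h2 : (inner ℝ z v) ^ 2 ≤ (‖z‖ * ‖v‖) ^ 2 := by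
      rw [← sq_abs]; gcongr
    rw [hSdef]
    nlinarith
  obtain ⟨r, ψ, hr, hrot⟩ := exists_polar _ _ _ hPQ
  refine ⟨ψ, fun θ => ?_⟩
  have h1 := rotate_norm_sq_add z v θ
  have h2 := rotate_norm_sq_sub z v θ
  rw [hrot] at h2
  rw [← hSdef] at h1
  set X := ‖Real.cos θ • z - Real.sin θ • v‖ ^ 2
  set Y := ‖Real.sin θ • z + Real.cos θ • v‖ ^ 2
  have h3 : (X - Y) ^ 2 ≤ S ^ 2 * Real.cos (2 * θ + ψ) ^ 2 := by
    rw [h2, mul_pow]; gcongr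
  have h4 : (1 + S) * (1 + S ^ 2 / (4 * (1 + S)) * Real.sin (2 * θ + ψ) ^ 2)
      = 1 + S + S ^ 2 * Real.sin (2 * θ + ψ) ^ 2 / 4 := by field_simp
  rw [h4]
  have h5 : 4 * (X * Y) = S ^ 2 - (X - Y) ^ 2 := by rw [← h1]; ring
  nlinarith [Real.sin_sq_add_cos_sq (2 * θ + ψ)]

theorem rotate_weight_le (z v : E) (θ : ℝ) {α : ℝ} (hα : 0 ≤ α) :
    ((1 + ‖Real.cos θ • z - Real.sin θ • v‖ ^ 2) *
        (1 + ‖Real.sin θ • z + Real.cos θ • v‖ ^ 2)) ^ (-α) ≤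
      (1 + (‖z‖ ^ 2 + ‖v‖ ^ 2)) ^ (-α) := by
  apply Real.rpow_le_rpow_of_nonpos (by positivity) _ (by linarith)
  rw [← rotate_norm_sq_add z v θ]
  nlinarith [mul_nonneg (sq_nonneg ‖Real.cos θ • z - Real.sin θ • v‖)
    (sq_nonneg ‖Real.sin θ • z + Real.cos θ • v‖)]

theorem lintegral_rotate_weight_le (z v : E) {α : ℝ} (hα : 0 ≤ α) :
    ∫⁻ θ in Set.Ioc 0 (Real.pi / 2),
      ENNReal.ofReal (((1 + ‖Real.cos θ • z - Real.sin θ • v‖ ^ 2) *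
        (1 + ‖Real.sin θ • z + Real.cos θ • v‖ ^ 2)) ^ (-α)) ≤
    ENNReal.ofReal (Real.pi / 2 * (1 + (‖z‖ ^ 2 + ‖v‖ ^ 2)) ^ (-α)) := by
  calc _ ≤ ∫⁻ θ in Set.Ioc 0 (Real.pi / 2),
        ENNReal.ofReal ((1 + (‖z‖ ^ 2 + ‖v‖ ^ 2)) ^ (-α)) :=
        lintegral_mono fun θ => ENNReal.ofReal_le_ofReal (rotate_weight_le z v θ hα)
    _ = _ := by
      rw [setLIntegral_const, Real.volume_Ioc, sub_zero, mul_comm,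
        ENNReal.ofReal_mul (by positivity)]

/-- Bernoulli with exponent `α/3 ≥ 1` replaces the power `α` by a cube, whose angular average is
explicit and does not depend on the phase. The coefficient `13/8` is `39/8` divided by `3`. -/
theorem lintegral_rotate_weight_le_of_three_le (z v : E) {α : ℝ} (hα : 3 ≤ α) :
    ∫⁻ θ in Set.Ioc 0 (Real.pi / 2),
      ENNReal.ofReal (((1 + ‖Real.cos θ • z - Real.sin θ • v‖ ^ 2) *
        (1 + ‖Real.sin θ • z + Real.cos θ • v‖ ^ 2)) ^ (-α)) ≤
    ENNReal.ofReal (Real.pi / 2 * (1 / √(11 / 20 + 13 / 8 * α *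
      ((‖z‖ ^ 2 + ‖v‖ ^ 2) ^ 2 / (4 * (1 + (‖z‖ ^ 2 + ‖v‖ ^ 2)))))) *
        (1 + (‖z‖ ^ 2 + ‖v‖ ^ 2)) ^ (-α)) := by
  obtain ⟨ψ, hψ⟩ := exists_phase_le_rotate z v
  set S := ‖z‖ ^ 2 + ‖v‖ ^ 2 with hSdef
  have hS : 0 ≤ S := by positivity
  set κ := S ^ 2 / (4 * (1 + S)) with hκ
  have hκ0 : 0 ≤ κ := by positivity
  set a := α / 3 * κ with ha
  have ha0 : 0 ≤ a := by positivity
  have hpt : ∀ θ : ℝ, ((1 + ‖Real.cos θ • z - Real.sin θ • v‖ ^ 2) *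
        (1 + ‖Real.sin θ • z + Real.cos θ • v‖ ^ 2)) ^ (-α) ≤
      (1 + S) ^ (-α) * ((1 + a * Real.sin (2 * θ + ψ) ^ 2) ^ 3)⁻¹ := by
    intro θ
    set σ := Real.sin (2 * θ + ψ) ^ 2
    have hσ : 0 ≤ σ := sq_nonneg _
    refine (Real.rpow_le_rpow_of_nonpos (by positivity) (hψ θ) (by linarith)).trans ?_
    rw [Real.mul_rpow (by positivity) (by positivity)]
    refine mul_le_mul_of_nonneg_left ?_ (by positivity)
    rw [Real.rpow_neg (by positivity)]
    refine inv_anti₀ (by positivity) ?_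
    have hb := one_add_mul_self_le_rpow_one_add (s := κ * σ) (by nlinarith [mul_nonneg hκ0 hσ])
      (show 1 ≤ α / 3 by linarith)
    calc (1 + a * σ) ^ 3 = (1 + α / 3 * (κ * σ)) ^ 3 := by rw [ha]; ring
      _ ≤ ((1 + κ * σ) ^ (α / 3)) ^ 3 := by gcongr
      _ = (1 + κ * σ) ^ α := by
        rw [← Real.rpow_natCast, ← Real.rpow_mul (by positivity)]
        congr 1; push_cast; ring
  have hcont := continuous_inv_one_add_mul_sin_sq_pow ha0 ψ
  calc _ ≤ ∫⁻ θ in Set.Ioc 0 (Real.pi / 2), ENNReal.ofReal ((1 + S) ^ (-α) *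
          ((1 + a * Real.sin (2 * θ + ψ) ^ 2) ^ 3)⁻¹) :=
        lintegral_mono fun θ => ENNReal.ofReal_le_ofReal (hpt θ)
    _ = ENNReal.ofReal (∫ θ in Set.Ioc 0 (Real.pi / 2), (1 + S) ^ (-α) *
          ((1 + a * Real.sin (2 * θ + ψ) ^ 2) ^ 3)⁻¹) := by
        refine (ofReal_integral_eq_lintegral_ofReal ?_ ?_).symm
        · exact (hcont.const_mul _).integrableOn_Ioc
        · exact Eventually.of_forall fun θ => by positivity
    _ ≤ _ := by
        apply ENNReal.ofReal_le_ofReal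
        rw [integral_const_mul, ← intervalIntegral.integral_of_le (by positivity),
          integral_inv_one_add_mul_sin_sq_pow ha0, mul_comm]
        refine mul_le_mul_of_nonneg_right ?_ (by positivity)
        refine mul_le_mul_of_nonneg_left ?_ (by positivity)
        refine (cube_average_le ha0).trans_eq ?_
        rw [ha]
        ring_nf

end Rotation

/-! ### Beta-type radial integrals and the normalizing constant -/

theorem lintegral_rpow_mul_exp_neg_mul_sq {q b : ℝ} (hq : -1 < q) (hb : 0 < b) :
    ∫⁻ x in Set.Ioi (0 : ℝ), ENNReal.ofReal (x ^ q * Real.exp (-b * x ^ 2)) =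
      ENNReal.ofReal (b ^ (-(q + 1) / 2) * (1 / 2) * Real.Gamma ((q + 1) / 2)) := by
  have h := integral_rpow_mul_exp_neg_mul_rpow (p := 2) two_pos hq hb
  simp only [Real.rpow_two] at h
  rw [← h, ofReal_integral_eq_lintegral_ofReal]
  · exact integrableOn_rpow_mul_exp_neg_mul_sq hb hq
  · filter_upwards [ae_restrict_mem measurableSet_Ioi] with x hx
    have : (0 : ℝ) < x := hx
    simp only [Pi.zero_apply]
    positivity

theorem lintegral_rpow_mul_exp_neg_mul {q b : ℝ} (hq : 0 < q) (hb : 0 < b) :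
    ∫⁻ x in Set.Ioi (0 : ℝ), ENNReal.ofReal (x ^ (q - 1) * Real.exp (-b * x)) =
      ENNReal.ofReal (b ^ (-q) * Real.Gamma q) := by
  have h := integral_rpow_mul_exp_neg_mul_rpow (p := 1) one_pos (show -1 < q - 1 by linarith) hb
  simp only [Real.rpow_one, sub_add_cancel, div_one, mul_one] at h
  have hi := integrableOn_rpow_mul_exp_neg_mul_rpow (p := 1) (s := q - 1) (by linarith) one_pos hb
  simp only [Real.rpow_one] at hi
  rw [← h, ofReal_integral_eq_lintegral_ofReal hi]
  filter_upwards [ae_restrict_mem measurableSet_Ioi] with x hx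
  have : (0 : ℝ) < x := hx
  simp only [Pi.zero_apply]
  positivity

/-- The Beta-type integral `∫₀^∞ r^q (c + r²)^(-α) dr`. -/
theorem lintegral_rpow_mul_add_sq_rpow {q α c : ℝ} (hq : -1 < q) (hα : (q + 1) / 2 < α)
    (hc : 0 < c) :
    ∫⁻ r in Set.Ioi (0 : ℝ), ENNReal.ofReal (r ^ q * (c + r ^ 2) ^ (-α)) =
      ENNReal.ofReal (c ^ ((q + 1) / 2 - α) *
        (Real.Gamma ((q + 1) / 2) * Real.Gamma (α - (q + 1) / 2) / (2 * Real.Gamma α))) := by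
  have hα0 : 0 < α := by linarith
  have hΓ := Real.Gamma_pos_of_pos hα0
  have hΓ' : ENNReal.ofReal (Real.Gamma α) ≠ 0 := by simpa using hΓ
  -- Write `Γ(α) (c + r²)^(-α)` as a Laplace integral in `τ`; after exchanging the integrals, the
  -- `r`-integral is Gaussian.
  have e1 : ∀ r ∈ Set.Ioi (0 : ℝ), ENNReal.ofReal (Real.Gamma α) *
      ENNReal.ofReal (r ^ q * (c + r ^ 2) ^ (-α)) =
      ∫⁻ τ in Set.Ioi (0 : ℝ), ENNReal.ofReal (τ ^ (α - 1) * Real.exp (-c * τ)) *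
        ENNReal.ofReal (r ^ q * Real.exp (-τ * r ^ 2)) := by
    intro r hr
    have hr0 : (0 : ℝ) < r := hr
    have h := lintegral_rpow_mul_exp_neg_mul hα0 (show 0 < c + r ^ 2 by positivity)
    rw [← ENNReal.ofReal_mul hΓ.le, show Real.Gamma α * (r ^ q * (c + r ^ 2) ^ (-α)) =
      r ^ q * ((c + r ^ 2) ^ (-α) * Real.Gamma α) by ring, ENNReal.ofReal_mul (by positivity), ← h,
      ← lintegral_const_mul _ (by fun_prop)]
    refine setLIntegral_congr_fun measurableSet_Ioi fun τ hτ => ?_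
    have hτ0 : (0 : ℝ) < τ := hτ
    rw [← ENNReal.ofReal_mul (by positivity), ← ENNReal.ofReal_mul (by positivity)]
    congr 1
    rw [show -(c + r ^ 2) * τ = -c * τ + -τ * r ^ 2 by ring, Real.exp_add]
    ring
  have e2 : ∀ τ ∈ Set.Ioi (0 : ℝ), ∫⁻ r in Set.Ioi (0 : ℝ),
      ENNReal.ofReal (τ ^ (α - 1) * Real.exp (-c * τ)) *
        ENNReal.ofReal (r ^ q * Real.exp (-τ * r ^ 2)) =
      ENNReal.ofReal (Real.Gamma ((q + 1) / 2) / 2) *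
        ENNReal.ofReal (τ ^ (α - (q + 1) / 2 - 1) * Real.exp (-c * τ)) := by
    intro τ hτ
    have hτ0 : (0 : ℝ) < τ := hτ
    have hG : 0 < Real.Gamma ((q + 1) / 2) := Real.Gamma_pos_of_pos (by linarith)
    rw [lintegral_const_mul _ (by fun_prop), lintegral_rpow_mul_exp_neg_mul_sq hq hτ0,
      ← ENNReal.ofReal_mul (by positivity), ← ENNReal.ofReal_mul (by positivity)]
    congr 1
    rw [show α - (q + 1) / 2 - 1 = (α - 1) + -(q + 1) / 2 by ring, Real.rpow_add hτ0]
    ring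
  have hG : 0 < Real.Gamma ((q + 1) / 2) := Real.Gamma_pos_of_pos (by linarith)
  have hG' : 0 < Real.Gamma (α - (q + 1) / 2) := Real.Gamma_pos_of_pos (by linarith)
  have key : ENNReal.ofReal (Real.Gamma α) *
      ∫⁻ r in Set.Ioi (0 : ℝ), ENNReal.ofReal (r ^ q * (c + r ^ 2) ^ (-α)) =
      ENNReal.ofReal (Real.Gamma α) * ENNReal.ofReal (c ^ ((q + 1) / 2 - α) *
        (Real.Gamma ((q + 1) / 2) * Real.Gamma (α - (q + 1) / 2) / (2 * Real.Gamma α))) := by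
    rw [← lintegral_const_mul _ (by fun_prop), setLIntegral_congr_fun measurableSet_Ioi e1,
      lintegral_lintegral_swap (by fun_prop), setLIntegral_congr_fun measurableSet_Ioi e2,
      lintegral_const_mul _ (by fun_prop),
      lintegral_rpow_mul_exp_neg_mul (by linarith) hc, ← ENNReal.ofReal_mul (by positivity),
      ← ENNReal.ofReal_mul (by positivity)]
    congr 1
    rw [show -(α - (q + 1) / 2) = (q + 1) / 2 - α by ring]
    field_simp
  exact (ENNReal.mul_right_inj hΓ' ENNReal.ofReal_ne_top).1 key

theorem integral_rpow_mul_add_sq_rpow {q α c : ℝ} (hq : -1 < q) (hα : (q + 1) / 2 < α)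
    (hc : 0 < c) :
    ∫ r in Set.Ioi (0 : ℝ), r ^ q * (c + r ^ 2) ^ (-α) =
      c ^ ((q + 1) / 2 - α) *
        (Real.Gamma ((q + 1) / 2) * Real.Gamma (α - (q + 1) / 2) / (2 * Real.Gamma α)) := by
  have hG : 0 < Real.Gamma ((q + 1) / 2) := Real.Gamma_pos_of_pos (by linarith)
  have hG' : 0 < Real.Gamma (α - (q + 1) / 2) := Real.Gamma_pos_of_pos (by linarith)
  have hΓ : 0 < Real.Gamma α := Real.Gamma_pos_of_pos (by linarith)
  rw [integral_eq_lintegral_of_nonneg_ae, lintegral_rpow_mul_add_sq_rpow hq hα hc,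
    ENNReal.toReal_ofReal (by positivity)]
  · filter_upwards [ae_restrict_mem measurableSet_Ioi] with x hx
    have : (0 : ℝ) < x := hx
    simp only [Pi.zero_apply]
    positivity
  · exact Measurable.aestronglyMeasurable (by fun_prop)

theorem cauchyNorm_eq {n : ℕ} (hn : 1 ≤ n) {α : ℝ} (hα : (n : ℝ) / 2 < α) :
    cauchyNorm n α = Real.pi ^ ((n : ℝ) / 2) * Real.Gamma (α - n / 2) / Real.Gamma α := by
  have : Nonempty (Fin n) := ⟨⟨0, hn⟩⟩
  have hn0 : (0 : ℝ) < n := by exact_mod_cast hn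
  unfold cauchyNorm
  rw [integral_fun_norm_addHaar volume (fun r => (1 + r ^ 2) ^ (-α)), finrank_euclideanSpace_fin]
  have h := integral_rpow_mul_add_sq_rpow (q := (n : ℝ) - 1) (α := α) (c := 1) (by linarith)
    (by linarith) one_pos
  have h2 : ∫ y in Set.Ioi (0 : ℝ), y ^ (n - 1) • (1 + y ^ 2) ^ (-α) =
      ∫ r in Set.Ioi (0 : ℝ), r ^ ((n : ℝ) - 1) * (1 + r ^ 2) ^ (-α) := by
    refine setIntegral_congr_fun measurableSet_Ioi fun r _ => ?_
    simp only [smul_eq_mul]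
    rw [← Real.rpow_natCast, Nat.cast_sub hn, Nat.cast_one]
  rw [h2, h, Measure.real, EuclideanSpace.volume_ball]
  have hg : Real.Gamma ((n : ℝ) / 2 + 1) = n / 2 * Real.Gamma (n / 2) :=
    Real.Gamma_add_one (by positivity)
  have hg0 : 0 < Real.Gamma ((n : ℝ) / 2) := Real.Gamma_pos_of_pos (by positivity)
  have hΓ : 0 < Real.Gamma α := Real.Gamma_pos_of_pos (by linarith)
  rw [Fintype.card_fin, ENNReal.ofReal_one, one_pow, one_mul, hg,
    ENNReal.toReal_ofReal (by positivity), Real.one_rpow, sub_add_cancel, nsmul_eq_mul,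
    smul_eq_mul, Real.sqrt_eq_rpow, ← Real.rpow_natCast, ← Real.rpow_mul Real.pi_pos.le]
  rw [show 1 / 2 * (n : ℝ) = n / 2 by ring]
  field_simp

/-! ### Linear functionals against radial weights -/

/-- In polar coordinates homogeneity splits off a spherical factor that does not depend on `φ`; the
functional supplies the extra power of `r` beyond `r^(n-1)`. -/
theorem lintegral_linear_mul_radial {n : ℕ} (hn : 1 ≤ n)
    (a : EuclideanSpace ℝ (Fin n)) {φ : ℝ → ENNReal} (hφ : Measurable φ) :
    ∫⁻ v : EuclideanSpace ℝ (Fin n), ‖(inner ℝ a v : ℝ)‖ₑ * φ ‖v‖ =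
      (∫⁻ ω : Metric.sphere (0 : EuclideanSpace ℝ (Fin n)) 1, ‖(inner ℝ a (ω : EuclideanSpace ℝ (Fin n)) : ℝ)‖ₑ
        ∂(volume : Measure (EuclideanSpace ℝ (Fin n))).toSphere) *
      ∫⁻ r in Set.Ioi (0 : ℝ), ENNReal.ofReal (r ^ (n : ℝ)) * φ r := by
  have : Nonempty (Fin n) := ⟨⟨0, hn⟩⟩
  have hmp := (volume : Measure (EuclideanSpace ℝ (Fin n))).measurePreserving_homeomorphUnitSphereProd
  rw [finrank_euclideanSpace_fin] at hmp
  have h1 : ∫⁻ v : EuclideanSpace ℝ (Fin n), ‖(inner ℝ a v : ℝ)‖ₑ * φ ‖v‖ =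
      ∫⁻ v : ({0}ᶜ : Set (EuclideanSpace ℝ (Fin n))), ‖(inner ℝ a (v : EuclideanSpace ℝ (Fin n)) : ℝ)‖ₑ *
        φ ‖(v : EuclideanSpace ℝ (Fin n))‖ ∂(Measure.comap Subtype.val volume) := by
    rw [lintegral_subtype_comap (measurableSet_singleton _).compl
      (fun v : EuclideanSpace ℝ (Fin n) => ‖(inner ℝ a v : ℝ)‖ₑ * φ ‖v‖), restrict_compl_singleton]
  have h2 := hmp.lintegral_comp_emb (Homeomorph.measurableEmbedding _)
    (fun p => (‖(inner ℝ a (p.1 : EuclideanSpace ℝ (Fin n)) : ℝ)‖ₑ) * (ENNReal.ofReal (p.2 : ℝ) * φ p.2))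
  rw [h1, show (∫⁻ v : ({0}ᶜ : Set (EuclideanSpace ℝ (Fin n))),
      ‖(inner ℝ a (v : EuclideanSpace ℝ (Fin n)) : ℝ)‖ₑ * φ ‖(v : EuclideanSpace ℝ (Fin n))‖
        ∂(Measure.comap Subtype.val volume)) = _ from Eq.trans (lintegral_congr fun v => ?_) h2,
    lintegral_prod_mul
      (f := fun ω : Metric.sphere (0 : EuclideanSpace ℝ (Fin n)) 1 =>
        ‖(inner ℝ a (ω : EuclideanSpace ℝ (Fin n)) : ℝ)‖ₑ)
      (g := fun r : Set.Ioi (0 : ℝ) => ENNReal.ofReal (r : ℝ) * φ r) (by fun_prop) (by fun_prop)]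
  · congr 1
    rw [Measure.volumeIoiPow, lintegral_withDensity_eq_lintegral_mul _ (by fun_prop) (by fun_prop)]
    simp only [Pi.mul_apply]
    rw [lintegral_subtype_comap measurableSet_Ioi
      (fun r : ℝ => ENNReal.ofReal (r ^ (n - 1)) * (ENNReal.ofReal r * φ r))]
    refine setLIntegral_congr_fun measurableSet_Ioi fun r hr => ?_
    have hr0 : (0 : ℝ) < r := hr
    rw [← mul_assoc, ← ENNReal.ofReal_mul (by positivity), ← pow_succ, Nat.sub_add_cancel hn,
      Real.rpow_natCast]
  · have hv : (0 : ℝ) < ‖(v : EuclideanSpace ℝ (Fin n))‖ := norm_pos_iff.2 v.2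
    simp only [homeomorphUnitSphereProd_apply_fst_coe, homeomorphUnitSphereProd_apply_snd_coe,
      inner_smul_right, enorm_mul]
    have e : ‖(‖(v : EuclideanSpace ℝ (Fin n))‖⁻¹ : ℝ)‖ₑ * ENNReal.ofReal ‖(v : EuclideanSpace ℝ (Fin n))‖ = 1 := by
      rw [Real.enorm_eq_ofReal (by positivity), ← ENNReal.ofReal_mul (by positivity),
        inv_mul_cancel₀ hv.ne', ENNReal.ofReal_one]
    rw [show ∀ x y z w : ENNReal, x * y * (z * w) = x * z * (y * w) by intros; ring, e, one_mul]

theorem lintegral_abs_coord_mul_gaussian {n : ℕ} (i₀ : Fin n) :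
    ∫⁻ v : EuclideanSpace ℝ (Fin n), ‖v i₀‖ₑ * ENNReal.ofReal (Real.exp (-‖v‖ ^ 2)) =
      ENNReal.ofReal (Real.pi ^ (((n : ℝ) - 1) / 2)) := by
  set f : Fin n → ℝ → ℝ := fun i x => (if i = i₀ then |x| else 1) * Real.exp (-x ^ 2) with hf
  have hg : Integrable (fun x : ℝ => Real.exp (-x ^ 2)) := by
    simpa using integrable_exp_neg_mul_sq one_pos
  have hax : Integrable (fun x : ℝ => |x| * Real.exp (-x ^ 2)) := by
    have h := (integrable_mul_exp_neg_mul_sq (b := 1) one_pos).norm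
    refine h.congr (Eventually.of_forall fun x => ?_)
    simp [abs_of_pos (Real.exp_pos _)]
  have hint : ∀ i, Integrable (f i) := by
    intro i
    by_cases h : i = i₀ <;> simp only [hf, h, if_true, if_false, one_mul]
    exacts [hax, hg]
  have hprod : ∫ x : Fin n → ℝ, ∏ i, f i (x i) = Real.pi ^ (((n : ℝ) - 1) / 2) := by
    rw [integral_fintype_prod_volume_eq_prod]
    have h1 : ∀ i, ∫ x, f i x = if i = i₀ then 1 else √Real.pi := by
      intro i
      by_cases h : i = i₀
      · simp only [hf, h, if_true]
        have h2 := integral_comp_abs (f := fun x : ℝ => x * Real.exp (-x ^ 2))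
        simp only [sq_abs] at h2
        rw [h2]
        have h3 := integral_rpow_mul_exp_neg_mul_rpow (p := 2) (q := 1) (b := 1) two_pos
          (by norm_num) one_pos
        norm_num at h3
        rw [h3]; norm_num
      · simp only [hf, h, if_false, one_mul]
        simpa using integral_gaussian 1
    have hn : 1 ≤ n := by have := i₀.2; omega
    simp only [h1]
    rw [Finset.prod_ite, Finset.prod_const_one, one_mul, Finset.prod_const,
      Finset.filter_ne' , Finset.card_erase_of_mem (Finset.mem_univ _), Finset.card_univ,
      Fintype.card_fin, Real.sqrt_eq_rpow, ← Real.rpow_natCast, ← Real.rpow_mul Real.pi_pos.le,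
      Nat.cast_sub hn]
    congr 1
    push_cast
    ring
  have hI : Integrable (fun x : Fin n → ℝ => ∏ i, f i (x i)) := Integrable.fintype_prod hint
  have hpt : ∀ x : Fin n → ℝ, ∏ i, f i (x i) = |x i₀| * Real.exp (-∑ i, x i ^ 2) := by
    intro x
    simp only [hf]
    rw [Finset.prod_mul_distrib, Finset.prod_ite_eq' Finset.univ i₀ (fun i => |x i|), ← Real.exp_sum,
      Finset.sum_neg_distrib]
    simp
  have hmp := EuclideanSpace.volume_preserving_symm_measurableEquiv_toLp (Fin n)
  have h3 := hmp.lintegral_comp_emb (MeasurableEquiv.measurableEmbedding _)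
    (fun x : Fin n → ℝ => ENNReal.ofReal (∏ i, f i (x i)))
  rw [← hprod, ofReal_integral_eq_lintegral_ofReal hI (Eventually.of_forall fun x => by
    simp only [hpt, Pi.zero_apply]; positivity), ← h3]
  refine lintegral_congr fun v => ?_
  rw [hpt, ← ofReal_norm, ← ENNReal.ofReal_mul (norm_nonneg _), EuclideanSpace.norm_sq_eq]
  simp

/-- A reflection carrying `‖a‖ e₀` to `a` reduces to a coordinate functional, where the Gaussian
integral factorizes. -/
theorem lintegral_abs_inner_mul_gaussian {n : ℕ} (hn : 1 ≤ n) (a : EuclideanSpace ℝ (Fin n)) :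
    ∫⁻ v : EuclideanSpace ℝ (Fin n), ‖(inner ℝ a v : ℝ)‖ₑ * ENNReal.ofReal (Real.exp (-‖v‖ ^ 2)) =
      ‖a‖ₑ * ENNReal.ofReal (Real.pi ^ (((n : ℝ) - 1) / 2)) := by
  set i₀ : Fin n := ⟨0, hn⟩
  set e : EuclideanSpace ℝ (Fin n) := EuclideanSpace.single i₀ ‖a‖ with he
  have hne : ‖e‖ = ‖a‖ := by simp [he]
  set R := (ℝ ∙ (e - a))ᗮ.reflection
  have hR : R e = a := Submodule.reflection_sub hne
  have hmp := LinearIsometryEquiv.measurePreserving R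
  rw [← hmp.lintegral_comp_emb R.toHomeomorph.measurableEmbedding,
    ← lintegral_abs_coord_mul_gaussian i₀, ← lintegral_const_mul _ (by fun_prop)]
  refine lintegral_congr fun v => ?_
  rw [← hR, R.inner_map_map, R.norm_map, R.enorm_map, he]
  rw [EuclideanSpace.inner_single_left]
  simp [mul_assoc, enorm_eq_nnnorm]

/-- Integration of `|L v|` against a radial weight. -/
theorem lintegral_enorm_dual_mul_radial {n : ℕ} (hn : 1 ≤ n)
    (L : EuclideanSpace ℝ (Fin n) →L[ℝ] ℝ) {φ : ℝ → ENNReal} (hφ : Measurable φ) :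
    ∫⁻ v : EuclideanSpace ℝ (Fin n), ‖L v‖ₑ * φ ‖v‖ =
      ‖L‖ₑ * ENNReal.ofReal (2 * Real.pi ^ (((n : ℝ) - 1) / 2) / Real.Gamma (((n : ℝ) + 1) / 2)) *
        ∫⁻ r in Set.Ioi (0 : ℝ), ENNReal.ofReal (r ^ (n : ℝ)) * φ r := by
  set a := (InnerProductSpace.toDual ℝ (EuclideanSpace ℝ (Fin n))).symm L with ha
  have hLa : ∀ v, L v = inner ℝ a v := fun v => by simp [ha]
  have hna : ‖L‖ₑ = ‖a‖ₑ := by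
    rw [← ofReal_norm, ← ofReal_norm, ha, LinearIsometryEquiv.norm_map]
  have hg : 0 < Real.Gamma (((n : ℝ) + 1) / 2) := Real.Gamma_pos_of_pos (by positivity)
  simp only [hLa]
  rw [lintegral_linear_mul_radial hn a hφ, hna]
  congr 1
  -- The spherical integral is never computed directly: it is read off by testing the factorization
  -- on the Gaussian.
  have h1 := lintegral_linear_mul_radial hn a
    (φ := fun r => ENNReal.ofReal (Real.exp (-r ^ 2))) (by fun_prop)
  rw [lintegral_abs_inner_mul_gaussian hn a] at h1
  have h2 := lintegral_rpow_mul_exp_neg_mul_sq (q := (n : ℝ)) (b := 1)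
    (by have : (0 : ℝ) ≤ n := by positivity
        linarith) one_pos
  have h3 : ∫⁻ r in Set.Ioi (0 : ℝ), ENNReal.ofReal (r ^ (n : ℝ)) * ENNReal.ofReal (Real.exp (-r ^ 2)) =
      ENNReal.ofReal (Real.Gamma (((n : ℝ) + 1) / 2) / 2) := by
    rw [Real.one_rpow, one_mul, one_div, inv_mul_eq_div] at h2
    rw [← h2]
    refine setLIntegral_congr_fun measurableSet_Ioi fun r hr => ?_
    have hr0 : (0 : ℝ) < r := hr
    rw [← ENNReal.ofReal_mul (by positivity), neg_one_mul]
  rw [h3] at h1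
  have h4 : ENNReal.ofReal (Real.Gamma (((n : ℝ) + 1) / 2) / 2) ≠ 0 := by simpa using hg
  apply (ENNReal.mul_left_inj h4 ENNReal.ofReal_ne_top).1
  rw [← h1, mul_assoc, ← ENNReal.ofReal_mul (by positivity)]
  congr 2
  field_simp

/-! ### The fibre estimate and its constant -/

/-- Tangent line bound for the concave function `u ↦ u / √(p u² + q)`. -/
theorem inv_sqrt_le_tangent {p q U u y : ℝ} (hp : 0 < p) (hq : 0 < q) (hU : 0 < U) (hu : 0 < u)
    (hy : q / u ^ 2 ≤ y) :
    1 / √(p + y) ≤ p * U ^ 3 / √(p * U ^ 2 + q) ^ 3 + q / √(p * U ^ 2 + q) ^ 3 * u := by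
  set W := √(p * U ^ 2 + q) with hWdef
  have hW : 0 < W := Real.sqrt_pos.2 (by positivity)
  have hW2 : W ^ 2 = p * U ^ 2 + q := Real.sq_sqrt (by positivity)
  have h0 : 0 < p + q / u ^ 2 := by positivity
  have h1 : 1 / √(p + y) ≤ 1 / √(p + q / u ^ 2) := by
    apply one_div_le_one_div_of_le (Real.sqrt_pos.2 h0)
    exact Real.sqrt_le_sqrt (by linarith)
  refine h1.trans ?_
  set w := √(p + q / u ^ 2) with hw
  have hw0 : 0 < w := Real.sqrt_pos.2 h0
  have hw2 : w ^ 2 = p + q / u ^ 2 := Real.sq_sqrt h0.le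
  rw [show p * U ^ 3 / W ^ 3 + q / W ^ 3 * u = (p * U ^ 3 + q * u) / W ^ 3 by ring,
    div_le_div_iff₀ hw0 (by positivity), one_mul]
  apply le_of_sq_le_sq _ (by positivity)
  have h2 : (W ^ 3) ^ 2 = (p * U ^ 2 + q) ^ 3 := by rw [← hW2]; ring
  rw [h2, mul_pow, hw2, show p + q / u ^ 2 = (p * u ^ 2 + q) / u ^ 2 by field_simp,
    ← mul_div_assoc, le_div_iff₀ (by positivity)]
  -- The difference carries the factor `(U - u)²`, expressing tangency at `u = U`.
  have h3 : (p * U ^ 3 + q * u) ^ 2 * (p * u ^ 2 + q) - (p * U ^ 2 + q) ^ 3 * u ^ 2 =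
      p * q * (U - u) ^ 2 * (p * U ^ 3 * (U + 2 * u) + q * u * (2 * U + u)) := by
    ring
  rw [← sub_nonneg, h3]
  positivity

/-- A radial bound on the rotated weight integrates to a bound with the weight `(1 + |z|²)^(-β)`. -/
theorem lintegral_rotate_weight_mul_dual_le {n : ℕ} (hn : 1 ≤ n) {α : ℝ}
    {φ : ℝ → ENNReal} (hφ : Measurable φ) (z : EuclideanSpace ℝ (Fin n))
    (L : EuclideanSpace ℝ (Fin n) →L[ℝ] ℝ)
    (hbound : ∀ v : EuclideanSpace ℝ (Fin n), v ≠ 0 → ∫⁻ θ in Set.Ioc 0 (Real.pi / 2),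
      ENNReal.ofReal (((1 + ‖Real.cos θ • z - Real.sin θ • v‖ ^ 2) *
        (1 + ‖Real.sin θ • z + Real.cos θ • v‖ ^ 2)) ^ (-α)) ≤ φ ‖v‖) :
    ∫⁻ v : EuclideanSpace ℝ (Fin n), ‖L v‖ₑ * ∫⁻ θ in Set.Ioc 0 (Real.pi / 2),
      ENNReal.ofReal (((1 + ‖Real.cos θ • z - Real.sin θ • v‖ ^ 2) *
        (1 + ‖Real.sin θ • z + Real.cos θ • v‖ ^ 2)) ^ (-α)) ≤
    ‖L‖ₑ * ENNReal.ofReal (2 * Real.pi ^ (((n : ℝ) - 1) / 2) / Real.Gamma (((n : ℝ) + 1) / 2)) *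
        ∫⁻ r in Set.Ioi (0 : ℝ), ENNReal.ofReal (r ^ (n : ℝ)) * φ r := by
  rw [← lintegral_enorm_dual_mul_radial hn L hφ]
  refine lintegral_mono fun v => ?_
  -- The radial bound may divide by `‖v‖²`; at the origin `L v = 0`, so no bound is needed there.
  rcases eq_or_ne v 0 with rfl | hv
  · simp
  · exact mul_le_mul_right (hbound v hv) _

/-- The radial integrals entering the rotation constant, at level `c = 1 + |z|²`. -/
theorem lintegral_radial_main {n : ℕ} {b c A : ℝ} (hb : 0 < b) (hc : 0 < c) (hA : 0 ≤ A) :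
    ∫⁻ r in Set.Ioi (0 : ℝ), ENNReal.ofReal (r ^ (n : ℝ)) *
      ENNReal.ofReal (A * (c + r ^ 2) ^ (-(b + n + 1 / 2))) =
    ENNReal.ofReal (A * (c ^ (-(b + n / 2)) * (Real.Gamma (((n : ℝ) + 1) / 2) *
      Real.Gamma (b + n / 2) / (2 * Real.Gamma (b + n + 1 / 2))))) := by
  have hn0 : (0 : ℝ) ≤ n := by positivity
  have h := lintegral_rpow_mul_add_sq_rpow (q := (n : ℝ)) (α := b + n + 1 / 2) (c := c)
    (by linarith) (by linarith) hc
  rw [show ((n : ℝ) + 1) / 2 - (b + n + 1 / 2) = -(b + n / 2) by ring,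
    show b + n + 1 / 2 - ((n : ℝ) + 1) / 2 = b + n / 2 by ring] at h
  rw [ENNReal.ofReal_mul hA, ← h, ← lintegral_const_mul _ (by fun_prop)]
  refine setLIntegral_congr_fun measurableSet_Ioi fun r hr => ?_
  have hr0 : (0 : ℝ) < r := hr
  rw [← ENNReal.ofReal_mul (by positivity), ← ENNReal.ofReal_mul hA]
  congr 1
  ring

/-- The factor `√c √(c + r²) / r²` is invariant under scaling `c` and `r²` together, so the same
power of `c` appears as in `lintegral_radial_main`. It lowers `r^n` to `r^(n-2)`, which is
integrable at `0` only for `n ≥ 2`. -/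
theorem lintegral_radial_tail {n : ℕ} (hn : 2 ≤ n) {b c A : ℝ} (hb : 0 < b) (hc : 0 < c)
    (hA : 0 ≤ A) :
    ∫⁻ r in Set.Ioi (0 : ℝ), ENNReal.ofReal (r ^ (n : ℝ)) *
      ENNReal.ofReal (A * (√c * √(c + r ^ 2) / r ^ 2) * (c + r ^ 2) ^ (-(b + n + 1 / 2))) =
    ENNReal.ofReal (A * (c ^ (-(b + n / 2)) * (Real.Gamma (((n : ℝ) - 1) / 2) *
      Real.Gamma (b + n / 2 + 1 / 2) / (2 * Real.Gamma (b + n))))) := by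
  have hn0 : (2 : ℝ) ≤ n := by exact_mod_cast hn
  have h := lintegral_rpow_mul_add_sq_rpow (q := (n : ℝ) - 2) (α := b + n) (c := c)
    (by linarith) (by linarith) hc
  rw [show ((n : ℝ) - 2 + 1) / 2 - (b + n) = -(b + n / 2) - 1 / 2 by ring,
    show b + n - ((n : ℝ) - 2 + 1) / 2 = b + n / 2 + 1 / 2 by ring,
    show (n : ℝ) - 2 + 1 = n - 1 by ring] at h
  have e : A * (c ^ (-(b + n / 2)) * (Real.Gamma (((n : ℝ) - 1) / 2) *
      Real.Gamma (b + n / 2 + 1 / 2) / (2 * Real.Gamma (b + n)))) =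
      A * √c * (c ^ (-(b + n / 2) - 1 / 2) * (Real.Gamma (((n : ℝ) - 1) / 2) *
      Real.Gamma (b + n / 2 + 1 / 2) / (2 * Real.Gamma (b + n)))) := by
    rw [Real.rpow_sub hc, Real.sqrt_eq_rpow]
    field_simp
  rw [e, ENNReal.ofReal_mul (by positivity), ← h, ← lintegral_const_mul _ (by fun_prop)]
  refine setLIntegral_congr_fun measurableSet_Ioi fun r hr => ?_
  have hr0 : (0 : ℝ) < r := hr
  have hcr : 0 < c + r ^ 2 := by positivity
  rw [← ENNReal.ofReal_mul (by positivity), ← ENNReal.ofReal_mul (by positivity)]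
  congr 1
  rw [Real.rpow_sub hr0, Real.rpow_two, show -(b + (n : ℝ) + 1 / 2) = -(b + n) - 1 / 2 by ring,
    Real.rpow_sub hcr, ← Real.sqrt_eq_rpow]
  have : 0 < √(c + r ^ 2) := Real.sqrt_pos.2 hcr
  field_simp

/-- Square of the slope scale used for the tangent line. -/
def tangentScaleSq (n : ℕ) (b : ℝ) : ℝ :=
  4 / ((n : ℝ) - 1) ^ 2 * ((b + n / 2) ^ 2 / (b + n / 2 + 1 / 4)) *
    ((b + n) ^ 2 / (b + n + 1 / 4))

/-- The mean of `u = √c √(c + r²) / r²` under the radial weight is `2/(n-1)` times two Gamma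
quotients; bounding each by Watson gives the square root of `tangentScaleSq`. -/
theorem Gamma_tail_le {n : ℕ} (hn : 2 ≤ n) {b : ℝ} (hb : 0 < b) :
    Real.Gamma (((n : ℝ) - 1) / 2) * Real.Gamma (b + n / 2 + 1 / 2) / (2 * Real.Gamma (b + n)) ≤
      √(tangentScaleSq n b) * (Real.Gamma (((n : ℝ) + 1) / 2) *
      Real.Gamma (b + n / 2) / (2 * Real.Gamma (b + n + 1 / 2))) := by
  have hn0 : (2 : ℝ) ≤ n := by exact_mod_cast hn
  have h1 := gammaQuotSq_le_watson (show 0 < b + (n : ℝ) / 2 by positivity)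
  have h2 := gammaQuotSq_le_watson (show 0 < b + (n : ℝ) by positivity)
  have g1 : 0 < Real.Gamma (b + (n : ℝ) / 2) := Real.Gamma_pos_of_pos (by positivity)
  have g2 : 0 < Real.Gamma (b + (n : ℝ) / 2 + 1 / 2) := Real.Gamma_pos_of_pos (by positivity)
  have g3 : 0 < Real.Gamma (b + (n : ℝ)) := Real.Gamma_pos_of_pos (by positivity)
  have g4 : 0 < Real.Gamma (b + (n : ℝ) + 1 / 2) := Real.Gamma_pos_of_pos (by positivity)
  have g5 : 0 < Real.Gamma (((n : ℝ) - 1) / 2) := Real.Gamma_pos_of_pos (by linarith)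
  have hn1 : (0 : ℝ) < (n - 1) / 2 := by linarith
  have hg : Real.Gamma (((n : ℝ) + 1) / 2) = ((n : ℝ) - 1) / 2 * Real.Gamma (((n : ℝ) - 1) / 2) := by
    rw [← Real.Gamma_add_one hn1.ne']
    congr 1; ring
  have hs : (2 / ((n : ℝ) - 1) * (Real.Gamma (b + n / 2 + 1 / 2) / Real.Gamma (b + n / 2)) *
      (Real.Gamma (b + n + 1 / 2) / Real.Gamma (b + n))) ^ 2 ≤ tangentScaleSq n b := by
    rw [mul_pow, mul_pow, div_pow]
    unfold tangentScaleSq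
    unfold gammaQuotSq at h1 h2
    have hp : 0 < (n : ℝ) - 1 := by linarith
    norm_num only
    gcongr
  have h3 := Real.le_sqrt_of_sq_le hs
  refine le_trans (le_of_eq ?_) (mul_le_mul_of_nonneg_right h3 (by rw [hg]; positivity))
  rw [hg]
  have hp : (n : ℝ) - 1 ≠ 0 := by linarith
  field_simp

theorem tangent_constant_le {n : ℕ} (hn : 2 ≤ n) {b : ℝ} (hb : 1 / 2 ≤ b) :
    (b + n / 2) * (tangentScaleSq n b /
      (11 / 20 * tangentScaleSq n b + 13 / 8 * (b + n + 1 / 2) / 4)) ≤ 8 * gammaQuotSq b := by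
  have hn0 : (2 : ℝ) ≤ n := by exact_mod_cast hn
  have hb0 : 0 < b := by linarith
  have h := rotation_constant_rational hn0 hb
  refine le_trans ?_ (mul_le_mul_of_nonneg_left (le_gammaQuotSq_watson hb0) (by norm_num))
  have hp : 0 < (n : ℝ) - 1 := by linarith
  have e : tangentScaleSq n b /
      (11 / 20 * tangentScaleSq n b + 13 / 8 * (b + n + 1 / 2) / 4) =
      16 * (b + n / 2) ^ 2 * (b + n) ^ 2 / (11 / 20 * (16 * (b + n / 2) ^ 2 * (b + n) ^ 2) +
          13 / 8 * ((b + n + 1 / 2) * (n - 1) ^ 2 * (b + n / 2 + 1 / 4) * (b + n + 1 / 4))) := by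
    unfold tangentScaleSq
    rw [div_eq_div_iff (by positivity) (by positivity)]
    field_simp
    ring
  rw [e, ← mul_div_assoc, ← mul_div_assoc, div_le_div_iff₀ (by positivity) (by positivity)]
  calc _ = 16 * (b + n / 2) ^ 3 * (b + n) ^ 2 * ((b + 1 / 2) ^ 2 * (b + 3 / 2) ^ 2) := by ring
    _ ≤ _ := h

/-- The case `n = 1`, `J = 1` of the constant bound, playing the role of `tangent_constant_le`. -/
theorem add_half_le_eight_mul_gammaQuotSq {b : ℝ} (hb : 1 / 2 ≤ b) : b + 1 / 2 ≤ 8 * gammaQuotSq b := by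
  refine le_trans ?_ (mul_le_mul_of_nonneg_left (le_gammaQuotSq_watson (by linarith)) (by norm_num))
  rw [← mul_div_assoc, le_div_iff₀ (by positivity)]
  obtain ⟨x, rfl⟩ : ∃ x, b = 1 / 2 + x := ⟨b - 1 / 2, by ring⟩
  have hx : 0 ≤ x := by linarith
  rw [← sub_nonneg]
  ring_nf
  positivity

/-- The value `π^((n-1)/2) Γ(b + n/2) / Γ(α)`, with `α = b + n + 1/2`, of the integral `∫ |v₁| (1 + |v|²)^(-α) dv`. -/
def linearMoment (n : ℕ) (b : ℝ) : ℝ :=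
  Real.pi ^ (((n : ℝ) - 1) / 2) * Real.Gamma (b + n / 2) / Real.Gamma (b + n + 1 / 2)

/-- The fibre estimate behind the rotation argument. -/
theorem exists_fibre_constant {n : ℕ} (hn : 1 ≤ n) {b : ℝ} (hb : 1 / 2 ≤ b) :
    ∃ J : ℝ, 0 ≤ J ∧ (b + n / 2) * J ^ 2 ≤ 8 * gammaQuotSq b ∧
      ∀ (z : EuclideanSpace ℝ (Fin n)) (L : EuclideanSpace ℝ (Fin n) →L[ℝ] ℝ),
        ∫⁻ v : EuclideanSpace ℝ (Fin n), ‖L v‖ₑ * ∫⁻ θ in Set.Ioc 0 (Real.pi / 2),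
          ENNReal.ofReal (((1 + ‖Real.cos θ • z - Real.sin θ • v‖ ^ 2) *
            (1 + ‖Real.sin θ • z + Real.cos θ • v‖ ^ 2)) ^ (-(b + n + 1 / 2))) ≤
        ‖L‖ₑ * ENNReal.ofReal (Real.pi / 2 * J * linearMoment n b *
          (1 + ‖z‖ ^ 2) ^ (-(b + n / 2))) := by
  have hb0 : 0 < b := by linarith
  have hn1 : (1 : ℝ) ≤ n := by exact_mod_cast hn
  have g0 : 0 < Real.Gamma (((n : ℝ) + 1) / 2) := Real.Gamma_pos_of_pos (by positivity)
  have g1 : 0 < Real.Gamma (b + (n : ℝ) / 2) := Real.Gamma_pos_of_pos (by positivity)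
  have g4 : 0 < Real.Gamma (b + (n : ℝ) + 1 / 2) := Real.Gamma_pos_of_pos (by positivity)
  set B := Real.Gamma (((n : ℝ) + 1) / 2) * Real.Gamma (b + n / 2) /
    (2 * Real.Gamma (b + n + 1 / 2)) with hB
  have hB0 : 0 < B := by positivity
  have hlm : 2 * Real.pi ^ (((n : ℝ) - 1) / 2) / Real.Gamma (((n : ℝ) + 1) / 2) * B =
      linearMoment n b := by
    rw [hB, linearMoment]; field_simp
  rcases hn.eq_or_lt with h1 | h2
  · subst h1
    refine ⟨1, zero_le_one, ?_, fun z L => ?_⟩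
    · have := add_half_le_eight_mul_gammaQuotSq hb
      simpa using this
    · have hc : 0 < 1 + ‖z‖ ^ 2 := by positivity
      refine (lintegral_rotate_weight_mul_dual_le le_rfl (α := b + (1 : ℕ) + 1 / 2)
        (φ := fun r => ENNReal.ofReal
          (Real.pi / 2 * (1 + ‖z‖ ^ 2 + r ^ 2) ^ (-(b + (1 : ℕ) + 1 / 2)))) (by fun_prop) z L
        fun v _ => ?_).trans (le_of_eq ?_)
      · rw [add_assoc 1]
        exact lintegral_rotate_weight_le z v (by positivity)
      · rw [lintegral_radial_main hb0 hc (by positivity), mul_assoc,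
          ← ENNReal.ofReal_mul (by positivity), ← hlm, ← hB]
        congr 2
        ring
  · have h2' : 2 ≤ n := h2
    have hn2 : (2 : ℝ) ≤ n := by exact_mod_cast h2'
    set q : ℝ := 13 / 8 * (b + n + 1 / 2) / 4 with hq
    have hq0 : 0 < q := by positivity
    have hT0 : 0 < tangentScaleSq n b := by
      have : 0 < (n : ℝ) - 1 := by linarith
      unfold tangentScaleSq; positivity
    -- `U` bounds the mean of `u`. Taking the tangent at `U` amounts to Jensen for the concave
    -- function `u / √(11/20 u² + q)`, whose value `U / W` at `U` becomes `J`.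
    set U := √(tangentScaleSq n b) with hU
    have hU0 : 0 < U := Real.sqrt_pos.2 hT0
    have hU2 : U ^ 2 = tangentScaleSq n b := Real.sq_sqrt hT0.le
    set W := √(11 / 20 * U ^ 2 + q) with hW
    have hW0 : 0 < W := Real.sqrt_pos.2 (by positivity)
    have hW2 : W ^ 2 = 11 / 20 * U ^ 2 + q := Real.sq_sqrt (by positivity)
    set A₀ := 11 / 20 * U ^ 3 / W ^ 3 with hA0
    set A₁ := q / W ^ 3 with hA1
    have hA0' : 0 ≤ A₀ := by positivity
    have hA1' : 0 ≤ A₁ := by positivity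
    have hAU : A₀ + A₁ * U = U / W := by
      rw [hA0, hA1, show 11 / 20 * U ^ 3 / W ^ 3 + q / W ^ 3 * U =
        U * (11 / 20 * U ^ 2 + q) / W ^ 3 by ring, ← hW2]
      field_simp
    refine ⟨U / W, by positivity, ?_, fun z L => ?_⟩
    · rw [div_pow, hW2, hU2]
      exact tangent_constant_le h2' hb
    · have hc : 0 < 1 + ‖z‖ ^ 2 := by positivity
      set c := 1 + ‖z‖ ^ 2 with hcdef
      have hc1 : 1 ≤ c := by rw [hcdef]; nlinarith [sq_nonneg ‖z‖]
      refine (lintegral_rotate_weight_mul_dual_le hn (α := b + n + 1 / 2)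
        (φ := fun r => ENNReal.ofReal (Real.pi / 2 * A₀ * (c + r ^ 2) ^ (-(b + n + 1 / 2))) +
          ENNReal.ofReal (Real.pi / 2 * A₁ * (√c * √(c + r ^ 2) / r ^ 2) *
            (c + r ^ 2) ^ (-(b + n + 1 / 2)))) (by fun_prop) z L fun v hv => ?_).trans ?_
      · have hv0 : 0 < ‖v‖ := norm_pos_iff.2 hv
        refine (lintegral_rotate_weight_le_of_three_le z v
          (show 3 ≤ b + n + 1 / 2 by linarith)).trans ?_
        rw [← ENNReal.ofReal_add (by positivity) (by positivity)]
        apply ENNReal.ofReal_le_ofReal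
        rw [← add_assoc 1, ← hcdef, ← add_mul,
          mul_assoc (Real.pi / 2) A₁, ← mul_add]
        refine mul_le_mul_of_nonneg_right ?_ (by positivity)
        refine mul_le_mul_of_nonneg_left ?_ (by positivity)
        have hcv : 0 < c + ‖v‖ ^ 2 := by positivity
        refine inv_sqrt_le_tangent (by norm_num) hq0 hU0 (by positivity) ?_
        have e : (√c * √(c + ‖v‖ ^ 2) / ‖v‖ ^ 2) ^ 2 = c * (c + ‖v‖ ^ 2) / (‖v‖ ^ 2) ^ 2 := by
          rw [div_pow, mul_pow, Real.sq_sqrt hc.le, Real.sq_sqrt hcv.le]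
        -- Dropping `‖z‖²` and dividing by `c ≥ 1` loses something, but produces the scale-invariant
        -- quantity `u`, which makes the final constant independent of `z`.
        have hS : (‖v‖ ^ 2) ^ 2 / c ≤ (‖z‖ ^ 2 + ‖v‖ ^ 2) ^ 2 := by
          rw [div_le_iff₀ hc]
          calc (‖v‖ ^ 2) ^ 2 ≤ (‖z‖ ^ 2 + ‖v‖ ^ 2) ^ 2 := by
                gcongr; nlinarith [sq_nonneg ‖z‖]
            _ ≤ _ := le_mul_of_one_le_right (by positivity) hc1
        rw [e, hq]
        calc 13 / 8 * (b + n + 1 / 2) / 4 / (c * (c + ‖v‖ ^ 2) / (‖v‖ ^ 2) ^ 2)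
            = 13 / 8 * (b + n + 1 / 2) * ((‖v‖ ^ 2) ^ 2 / c / (4 * (c + ‖v‖ ^ 2))) := by
              field_simp
          _ ≤ 13 / 8 * (b + n + 1 / 2) * ((‖z‖ ^ 2 + ‖v‖ ^ 2) ^ 2 / (4 * (c + ‖v‖ ^ 2))) := by
              gcongr
      · have gt := Gamma_tail_le h2' hb0
        rw [← hU, ← hB] at gt
        set B' := Real.Gamma (((n : ℝ) - 1) / 2) * Real.Gamma (b + n / 2 + 1 / 2) /
          (2 * Real.Gamma (b + n)) with hB'
        have hB'0 : 0 ≤ B' := by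
          have a1 : 0 < Real.Gamma (((n : ℝ) - 1) / 2) := Real.Gamma_pos_of_pos (by linarith)
          have a2 : 0 < Real.Gamma (b + (n : ℝ) / 2 + 1 / 2) := Real.Gamma_pos_of_pos (by positivity)
          have a3 : 0 < Real.Gamma (b + (n : ℝ)) := Real.Gamma_pos_of_pos (by positivity)
          positivity
        simp only [mul_add]
        rw [lintegral_add_left (by fun_prop), lintegral_radial_main hb0 hc (by positivity),
          lintegral_radial_tail h2' hb0 hc (by positivity), ← hB, ← hB',
          ← ENNReal.ofReal_add (by positivity) (by positivity), mul_assoc,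
          ← ENNReal.ofReal_mul (by positivity)]
        refine mul_le_mul_right (ENNReal.ofReal_le_ofReal ?_) _
        rw [← hlm, ← hAU]
        set k := 2 * Real.pi ^ (((n : ℝ) - 1) / 2) / Real.Gamma (((n : ℝ) + 1) / 2) with hk
        have hk0 : 0 ≤ k := by positivity
        calc k * (Real.pi / 2 * A₀ * (c ^ (-(b + n / 2)) * B) +
              Real.pi / 2 * A₁ * (c ^ (-(b + n / 2)) * B'))
            = k * (Real.pi / 2) * c ^ (-(b + (n : ℝ) / 2)) * (A₀ * B + A₁ * B') := by ring
          _ ≤ k * (Real.pi / 2) * c ^ (-(b + (n : ℝ) / 2)) * (A₀ * B + A₁ * (U * B)) := by gcongr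
          _ = _ := by ring

/-! ### The rotation argument -/

section Path

variable {E : Type*} [NormedAddCommGroup E] [InnerProductSpace ℝ E]

/-- The fundamental theorem of calculus along a quarter circle from `x` to `y`: position and
velocity are together a rotation of the pair `(x, y)`, which a straight segment would not give. -/
theorem enorm_sub_le_lintegral_rotate {g : E → ℝ} (hg : ContDiff ℝ 1 g) (x y : E) :
    ‖g x - g y‖ₑ ≤ ∫⁻ θ in Set.Ioc 0 (Real.pi / 2),
      ‖fderiv ℝ g (Real.cos θ • x + Real.sin θ • y) (-Real.sin θ • x + Real.cos θ • y)‖ₑ := by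
  have hd : ∀ θ : ℝ, HasDerivAt (fun θ : ℝ => g (Real.cos θ • x + Real.sin θ • y))
      (fderiv ℝ g (Real.cos θ • x + Real.sin θ • y) (-Real.sin θ • x + Real.cos θ • y)) θ := by
    intro θ
    have h1 : HasDerivAt (fun θ : ℝ => Real.cos θ • x + Real.sin θ • y)
        (-Real.sin θ • x + Real.cos θ • y) θ :=
      ((Real.hasDerivAt_cos θ).smul_const x).add ((Real.hasDerivAt_sin θ).smul_const y)
    exact ((hg.differentiable one_ne_zero _).hasFDerivAt).comp_hasDerivAt θ h1
  have hcont : Continuous fun θ : ℝ =>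
      fderiv ℝ g (Real.cos θ • x + Real.sin θ • y) (-Real.sin θ • x + Real.cos θ • y) := by
    have := hg.continuous_fderiv one_ne_zero
    fun_prop
  have h := intervalIntegral.integral_eq_sub_of_hasDerivAt (fun θ _ => hd θ)
    (hcont.intervalIntegrable 0 (Real.pi / 2))
  simp only [Real.cos_zero, Real.sin_zero, Real.cos_pi_div_two, Real.sin_pi_div_two, one_smul,
    zero_smul, add_zero, zero_add] at h
  rw [intervalIntegral.integral_of_le (by positivity)] at h
  rw [← enorm_neg, neg_sub, ← h]
  exact enorm_integral_le_lintegral_enorm _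

end Path

section Rotation

variable {E : Type*} [NormedAddCommGroup E] [InnerProductSpace ℝ E] [FiniteDimensional ℝ E]
  [MeasurableSpace E] [BorelSpace E]

theorem measurePreserving_shear_snd (s : ℝ) :
    MeasurePreserving (fun p : E × E => (p.1, p.2 + s • p.1)) (volume.prod volume)
      (volume.prod volume) :=
  (MeasurePreserving.id volume).skew_product (g := fun x y => y + s • x) (by fun_prop)
    (Eventually.of_forall fun x => (measurePreserving_add_right volume (s • x)).map_eq)

theorem measurePreserving_shear_fst (s : ℝ) :
    MeasurePreserving (fun p : E × E => (p.1 + s • p.2, p.2)) (volume.prod volume)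
      (volume.prod volume) := by
  have h := (Measure.measurePreserving_swap (μ := (volume : Measure E)) (ν := volume)).comp
    ((measurePreserving_shear_snd (E := E) s).comp Measure.measurePreserving_swap)
  exact h

/-- Rotations of pairs of vectors preserve Lebesgue measure. -/
theorem measurePreserving_rotate {θ : ℝ} (hθ : Real.cos (θ / 2) ≠ 0) :
    MeasurePreserving (fun p : E × E => (Real.cos θ • p.1 - Real.sin θ • p.2,
      Real.sin θ • p.1 + Real.cos θ • p.2)) (volume.prod volume) (volume.prod volume) := by
  -- With `τ = tan(θ/2)`, the rotation is the product of three shears with slopes `-τ`, `sin θ`,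
  -- `-τ`.
  set τ := Real.sin (θ / 2) / Real.cos (θ / 2) with hτ
  have hs : Real.sin θ = 2 * Real.sin (θ / 2) * Real.cos (θ / 2) := by
    rw [← Real.sin_two_mul]; congr 1; ring
  have hc : Real.cos θ = 2 * Real.cos (θ / 2) ^ 2 - 1 := by
    rw [← Real.cos_two_mul]; congr 1; ring
  have h1 := Real.sin_sq_add_cos_sq (θ / 2)
  have e1 : 1 - τ * Real.sin θ = Real.cos θ := by
    rw [hτ, hs, hc]; field_simp; linear_combination -2 * h1
  have e2 : τ * (1 + Real.cos θ) = Real.sin θ := by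
    rw [hτ, hs, hc]; field_simp; ring
  have h := (measurePreserving_shear_fst (E := E) (-τ)).comp
    ((measurePreserving_shear_snd (Real.sin θ)).comp (measurePreserving_shear_fst (-τ)))
  convert h using 1
  funext p
  simp only [Function.comp]
  ext1
  · simp only
    rw [show p.1 + -τ • p.2 + -τ • (p.2 + Real.sin θ • (p.1 + -τ • p.2)) =
      (1 - τ * Real.sin θ) • p.1 - (τ * (1 + (1 - τ * Real.sin θ))) • p.2 by module, e1, e2]
  · simp only
    rw [show p.2 + Real.sin θ • (p.1 + -τ • p.2) =
      Real.sin θ • p.1 + (1 - τ * Real.sin θ) • p.2 by module, e1]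

/-- The rotation argument: a fibrewise bound on the rotated pair weight `F` controls the
`F`-weighted oscillation of `g` by a weighted integral of its gradient. -/
theorem lintegral_oscillation_le {F : E × E → ENNReal} (hF : Measurable F) {w : E → ENNReal}
    (hK : ∀ (z : E) (L : E →L[ℝ] ℝ), ∫⁻ v, ‖L v‖ₑ * ∫⁻ θ in Set.Ioc 0 (Real.pi / 2),
      F (Real.cos θ • z - Real.sin θ • v, Real.sin θ • z + Real.cos θ • v) ≤ ‖L‖ₑ * w z)
    {g : E → ℝ} (hg : ContDiff ℝ 1 g) :
    ∫⁻ p : E × E, F p * ‖g p.1 - g p.2‖ₑ ∂(volume.prod volume) ≤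
      ∫⁻ z, ‖fderiv ℝ g z‖ₑ * w z := by
  have hDg := hg.continuous_fderiv one_ne_zero
  have hmeas : Measurable fun q : ℝ × (E × E) =>
      F (Real.cos q.1 • q.2.1 - Real.sin q.1 • q.2.2, Real.sin q.1 • q.2.1 + Real.cos q.1 • q.2.2) := by
    fun_prop
  have hmeas2 : Measurable fun q : (E × E) × ℝ =>
      ‖fderiv ℝ g (Real.cos q.2 • q.1.1 + Real.sin q.2 • q.1.2)
        (-Real.sin q.2 • q.1.1 + Real.cos q.2 • q.1.2)‖ₑ := by
    apply Continuous.measurable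
    fun_prop
  calc _ ≤ ∫⁻ p : E × E, (∫⁻ θ in Set.Ioc 0 (Real.pi / 2), F p *
        ‖fderiv ℝ g (Real.cos θ • p.1 + Real.sin θ • p.2)
          (-Real.sin θ • p.1 + Real.cos θ • p.2)‖ₑ) ∂(volume.prod volume) := by
        refine lintegral_mono fun p => ?_
        have hm : Measurable fun θ : ℝ =>
            ‖fderiv ℝ g (Real.cos θ • p.1 + Real.sin θ • p.2)
              (-Real.sin θ • p.1 + Real.cos θ • p.2)‖ₑ := by
          apply Continuous.measurable
          fun_prop
        rw [lintegral_const_mul _ hm]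
        exact mul_le_mul_right (enorm_sub_le_lintegral_rotate hg p.1 p.2) _
    _ = ∫⁻ θ in Set.Ioc 0 (Real.pi / 2), ∫⁻ p : E × E, F p *
        ‖fderiv ℝ g (Real.cos θ • p.1 + Real.sin θ • p.2)
          (-Real.sin θ • p.1 + Real.cos θ • p.2)‖ₑ ∂(volume.prod volume) :=
        lintegral_lintegral_swap ((hF.comp measurable_fst).mul hmeas2).aemeasurable
    _ = ∫⁻ θ in Set.Ioc 0 (Real.pi / 2), ∫⁻ p : E × E,
        F (Real.cos θ • p.1 - Real.sin θ • p.2, Real.sin θ • p.1 + Real.cos θ • p.2) *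
          ‖fderiv ℝ g p.1 p.2‖ₑ ∂(volume.prod volume) := by
        refine setLIntegral_congr_fun measurableSet_Ioc fun θ hθ => ?_
        have hcos : Real.cos (θ / 2) ≠ 0 :=
          (Real.cos_pos_of_mem_Ioo ⟨by linarith [hθ.1, Real.pi_pos], by linarith [hθ.2, Real.pi_pos]⟩).ne'
        have hmp := measurePreserving_rotate (E := E) hcos
        have hm : Measurable fun p : E × E => F p *
          ‖fderiv ℝ g (Real.cos θ • p.1 + Real.sin θ • p.2)
            (-Real.sin θ • p.1 + Real.cos θ • p.2)‖ₑ :=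
          hF.mul (by
            apply Continuous.measurable
            fun_prop)
        -- Substituting the rotated pair for `p` turns position into the first coordinate and
        -- velocity into the second, moving all dependence on `θ` into the weight.
        rw [← hmp.lintegral_comp hm]
        refine lintegral_congr fun p => ?_
        have hsc := Real.sin_sq_add_cos_sq θ
        simp only
        rw [show Real.cos θ • (Real.cos θ • p.1 - Real.sin θ • p.2) +
            Real.sin θ • (Real.sin θ • p.1 + Real.cos θ • p.2) =
            (Real.sin θ ^ 2 + Real.cos θ ^ 2) • p.1 by module,
          show -Real.sin θ • (Real.cos θ • p.1 - Real.sin θ • p.2) +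
            Real.cos θ • (Real.sin θ • p.1 + Real.cos θ • p.2) =
            (Real.sin θ ^ 2 + Real.cos θ ^ 2) • p.2 by module, hsc, one_smul, one_smul]
    _ = ∫⁻ p : E × E, (∫⁻ θ in Set.Ioc 0 (Real.pi / 2),
        F (Real.cos θ • p.1 - Real.sin θ • p.2, Real.sin θ • p.1 + Real.cos θ • p.2) *
          ‖fderiv ℝ g p.1 p.2‖ₑ) ∂(volume.prod volume) := by
        refine lintegral_lintegral_swap (Measurable.aemeasurable ?_)
        refine hmeas.mul ?_
        apply Continuous.measurable
        fun_prop
    _ = ∫⁻ p : E × E, ‖fderiv ℝ g p.1 p.2‖ₑ * (∫⁻ θ in Set.Ioc 0 (Real.pi / 2),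
        F (Real.cos θ • p.1 - Real.sin θ • p.2, Real.sin θ • p.1 + Real.cos θ • p.2))
          ∂(volume.prod volume) := by
        refine lintegral_congr fun p => ?_
        have hm : Measurable fun θ : ℝ =>
            F (Real.cos θ • p.1 - Real.sin θ • p.2, Real.sin θ • p.1 + Real.cos θ • p.2) := by
          fun_prop
        rw [lintegral_mul_const _ hm, mul_comm]
    _ = ∫⁻ z, ∫⁻ v, ‖fderiv ℝ g z v‖ₑ * (∫⁻ θ in Set.Ioc 0 (Real.pi / 2),
        F (Real.cos θ • z - Real.sin θ • v, Real.sin θ • z + Real.cos θ • v)) := by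
        refine lintegral_prod _ (Measurable.aemeasurable ?_)
        refine Measurable.mul ?_ ?_
        · apply Continuous.measurable
          fun_prop
        · exact Measurable.lintegral_prod_left' (f := fun q : ℝ × (E × E) =>
            F (Real.cos q.1 • q.2.1 - Real.sin q.1 • q.2.2,
              Real.sin q.1 • q.2.1 + Real.cos q.1 • q.2.2)) hmeas
    _ ≤ _ := lintegral_mono fun z => hK z (fderiv ℝ g z)

end Rotation

/-! ### Smooth cutoffs -/

/-- Smooth separation of a set from the complement of its `ε`-neighbourhood, with nearly optimal
gradient bound. -/
theorem exists_contDiff_separation {E : Type*} [NormedAddCommGroup E] [InnerProductSpace ℝ E]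
    [FiniteDimensional ℝ E] {A : Set E} (hA : A.Nonempty) {ε δ : ℝ} (hδ : 0 < δ)
    (hε : 2 * δ < ε) :
    ∃ g : E → ℝ, ContDiff ℝ 1 g ∧ (∀ x, 0 ≤ g x) ∧ (∀ x, g x ≤ 1) ∧ (∀ x ∈ A, g x = 0) ∧
      (∀ x ∉ Metric.thickening ε A, g x = 1) ∧ ∀ x, ‖fderiv ℝ g x‖ ≤ 1 / (ε - 2 * δ) := by
  borelize E
  have hw : 0 < ε - 2 * δ := by linarith
  -- The ramp is flat for distance at most `δ` and at least `ε - δ`, so mollifying at radius `δ`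
  -- keeps the values on `A` and off the thickening exact; its slope is `1 / (ε - 2δ)`.
  set f : E → ℝ := fun x => min 1 (max 0 ((Metric.infDist x A - δ) / (ε - 2 * δ))) with hf
  have hf0 : ∀ x, 0 ≤ f x := fun x => le_min zero_le_one (le_max_left _ _)
  have hf1 : ∀ x, f x ≤ 1 := fun x => min_le_left _ _
  have hfd : ∀ x y, |f x - f y| ≤ 1 / (ε - 2 * δ) * dist x y := by
    intro x y
    calc |f x - f y| ≤ |max 0 ((Metric.infDist x A - δ) / (ε - 2 * δ)) -
          max 0 ((Metric.infDist y A - δ) / (ε - 2 * δ))| :=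
          (abs_min_sub_min_le_max _ _ _ _).trans (by simp)
      _ ≤ |(Metric.infDist x A - δ) / (ε - 2 * δ) - (Metric.infDist y A - δ) / (ε - 2 * δ)| :=
          (abs_max_sub_max_le_max _ _ _ _).trans (by simp)
      _ = 1 / (ε - 2 * δ) * |Metric.infDist x A - Metric.infDist y A| := by
          rw [← sub_div, sub_sub_sub_cancel_right, abs_div, abs_of_pos hw]; ring
      _ ≤ 1 / (ε - 2 * δ) * dist x y := by
          have := (Metric.lipschitz_infDist_pt A).dist_le_mul x y
          rw [NNReal.coe_one, one_mul, Real.dist_eq] at this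
          gcongr
  have hfc : Continuous f := by
    have := Metric.continuous_infDist_pt A
    fun_prop
  let φ : ContDiffBump (0 : E) := ⟨δ / 2, δ, by linarith, by linarith⟩
  have hφc : HasCompactSupport (φ.normed volume) := φ.hasCompactSupport_normed
  have hconv : ∀ x, Integrable (fun t => φ.normed volume t * f (x - t)) := by
    intro x
    have h1 : Integrable (φ.normed volume) := φ.integrable_normed
    refine h1.mul_bdd (c := 1) (by fun_prop) (Eventually.of_forall fun t => ?_)
    rw [Real.norm_eq_abs, abs_of_nonneg (hf0 _)]
    exact hf1 _
  set g : E → ℝ := convolution (φ.normed volume) f (ContinuousLinearMap.lsmul ℝ ℝ) volume with hg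
  have hgx : ∀ x, g x = ∫ t, φ.normed volume t * f (x - t) := fun x => by
    simp [hg, convolution_def]
  have hint1 : ∫ t, φ.normed volume t = (1 : ℝ) := φ.integral_normed
  refine ⟨g, ?_, ?_, ?_, ?_, ?_, ?_⟩
  · exact hφc.contDiff_convolution_left (n := 1) _ φ.contDiff_normed hfc.locallyIntegrable
  · intro x
    rw [hgx]
    exact integral_nonneg fun t => mul_nonneg (φ.nonneg_normed t) (hf0 _)
  · intro x
    rw [hgx, ← hint1]
    refine integral_mono (hconv x) φ.integrable_normed fun t => ?_
    exact mul_le_of_le_one_right (φ.nonneg_normed t) (hf1 _)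
  · intro x hx
    have hloc : ∀ y ∈ Metric.ball x φ.rOut, f y = 0 := by
      intro y hy
      have h1 : Metric.infDist y A ≤ dist y x := Metric.infDist_le_dist_of_mem hx
      have h2 : dist y x < δ := hy
      simp only [hf]
      rw [max_eq_left, min_eq_right zero_le_one]
      exact div_nonpos_of_nonpos_of_nonneg (by linarith) hw.le
    rw [hg, ContDiffBump.normed_convolution_eq_right]
    · exact hloc x (Metric.mem_ball_self φ.rOut_pos)
    · intro y hy
      rw [hloc y hy, hloc x (Metric.mem_ball_self φ.rOut_pos)]
  · intro x hx
    have hxe : ε ≤ Metric.infDist x A := by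
      by_contra! h
      exact hx ((Metric.mem_thickening_iff_infDist_lt hA).2 h)
    have hloc : ∀ y ∈ Metric.ball x φ.rOut, f y = 1 := by
      intro y hy
      have h1 : Metric.infDist x A ≤ Metric.infDist y A + dist x y :=
        Metric.infDist_le_infDist_add_dist
      have h2 : dist y x < δ := hy
      rw [dist_comm] at h2
      have h3 : 1 ≤ (Metric.infDist y A - δ) / (ε - 2 * δ) := by
        rw [le_div_iff₀ hw]; linarith
      exact min_eq_left (h3.trans (le_max_right _ _))
    rw [hg, ContDiffBump.normed_convolution_eq_right]
    · exact hloc x (Metric.mem_ball_self φ.rOut_pos)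
    · intro y hy
      rw [hloc y hy, hloc x (Metric.mem_ball_self φ.rOut_pos)]
  · intro x
    have hL : LipschitzWith (Real.toNNReal (1 / (ε - 2 * δ))) g := by
      refine LipschitzWith.of_dist_le_mul fun x y => ?_
      rw [Real.coe_toNNReal _ (by positivity), Real.dist_eq, hgx, hgx,
        ← integral_sub (hconv x) (hconv y)]
      have hb : ∀ t, ‖φ.normed volume t * f (x - t) - φ.normed volume t * f (y - t)‖ ≤
          φ.normed volume t * (1 / (ε - 2 * δ) * dist x y) := by
        intro t
        rw [← mul_sub, norm_mul, Real.norm_of_nonneg (φ.nonneg_normed t), Real.norm_eq_abs]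
        refine mul_le_mul_of_nonneg_left ?_ (φ.nonneg_normed t)
        have := hfd (x - t) (y - t)
        rwa [dist_sub_right] at this
      have h := norm_integral_le_of_norm_le (φ.integrable_normed.mul_const _)
        (Eventually.of_forall hb)
      rwa [integral_mul_const, hint1, one_mul, Real.norm_eq_abs] at h
    have := norm_fderiv_le_of_lipschitz ℝ (x₀ := x) hL
    rwa [Real.coe_toNNReal _ (by positivity)] at this

/-! ### From the functional inequality to perimeter -/

theorem cauchyNorm_pos {n : ℕ} (hn : 1 ≤ n) {α : ℝ} (hα : (n : ℝ) / 2 < α) :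
    0 < cauchyNorm n α := by
  have hn1 : (1 : ℝ) ≤ n := by exact_mod_cast hn
  rw [cauchyNorm_eq hn hα]
  have h1 : 0 < Real.Gamma (α - n / 2) := Real.Gamma_pos_of_pos (by linarith)
  have h2 : 0 < Real.Gamma α := Real.Gamma_pos_of_pos (by linarith)
  positivity

theorem setLIntegral_cauchy_weight {n : ℕ} (hn : 1 ≤ n) {α : ℝ} (hα : (n : ℝ) / 2 < α)
    {s : Set (EuclideanSpace ℝ (Fin n))} (hs : MeasurableSet s) :
    ∫⁻ x in s, ENNReal.ofReal ((1 + ‖x‖ ^ 2) ^ (-α)) =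
      ENNReal.ofReal (cauchyNorm n α) * cauchyMeasure n α s := by
  have hN := cauchyNorm_pos hn hα
  rw [cauchyMeasure, withDensity_apply _ hs, ← lintegral_const_mul _ (by fun_prop)]
  refine lintegral_congr fun x => ?_
  rw [← ENNReal.ofReal_mul hN.le]
  congr 1
  field_simp

theorem volume_absolutelyContinuous_cauchyMeasure {n : ℕ} (hn : 1 ≤ n) {α : ℝ}
    (hα : (n : ℝ) / 2 < α) :
    (volume : Measure (EuclideanSpace ℝ (Fin n))) ≪ cauchyMeasure n α := by
  have hN := cauchyNorm_pos hn hα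
  refine withDensity_absolutelyContinuous' (Measurable.aemeasurable (by fun_prop))
    (Eventually.of_forall fun x => ?_)
  rw [Ne, ENNReal.ofReal_eq_zero, not_le]
  positivity

/-- Lower bound for the oscillation integral of a function separating `A` from `B`. -/
theorem le_lintegral_oscillation {n : ℕ} (hn : 1 ≤ n) {α : ℝ} (hα : (n : ℝ) / 2 < α)
    {A B : Set (EuclideanSpace ℝ (Fin n))} (hA : MeasurableSet A) (hB : MeasurableSet B)
    {g : EuclideanSpace ℝ (Fin n) → ℝ} (hgA : ∀ x ∈ A, g x = 0) (hgB : ∀ x ∈ B, g x = 1) :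
    ENNReal.ofReal (2 * cauchyNorm n α ^ 2) * (cauchyMeasure n α A * cauchyMeasure n α B) ≤
      ∫⁻ p : EuclideanSpace ℝ (Fin n) × EuclideanSpace ℝ (Fin n),
        ENNReal.ofReal (((1 + ‖p.1‖ ^ 2) * (1 + ‖p.2‖ ^ 2)) ^ (-α)) * ‖g p.1 - g p.2‖ₑ
          ∂(volume.prod volume) := by
  have hN := cauchyNorm_pos hn hα
  set w : EuclideanSpace ℝ (Fin n) → ENNReal := fun x => ENNReal.ofReal ((1 + ‖x‖ ^ 2) ^ (-α))
    with hw
  have hwm : Measurable w := by fun_prop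
  have hwA : AEMeasurable (A.indicator w) volume := (hwm.indicator hA).aemeasurable
  have hwB : AEMeasurable (B.indicator w) volume := (hwm.indicator hB).aemeasurable
  have hiA : ∫⁻ x, A.indicator w x = ENNReal.ofReal (cauchyNorm n α) * cauchyMeasure n α A := by
    rw [lintegral_indicator hA, setLIntegral_cauchy_weight hn hα hA]
  have hiB : ∫⁻ x, B.indicator w x = ENNReal.ofReal (cauchyNorm n α) * cauchyMeasure n α B := by
    rw [lintegral_indicator hB, setLIntegral_cauchy_weight hn hα hB]
  -- Pairs in `A × B` and in `B × A` contribute equally, whence the factor `2`.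
  have h1 : ENNReal.ofReal (2 * cauchyNorm n α ^ 2) *
      (cauchyMeasure n α A * cauchyMeasure n α B) =
      ∫⁻ p : EuclideanSpace ℝ (Fin n) × EuclideanSpace ℝ (Fin n),
        (A.indicator w p.1 * B.indicator w p.2 + B.indicator w p.1 * A.indicator w p.2)
          ∂(volume.prod volume) := by
    have hm : AEMeasurable (fun p : EuclideanSpace ℝ (Fin n) × EuclideanSpace ℝ (Fin n) =>
        A.indicator w p.1 * B.indicator w p.2) (volume.prod volume) :=
      hwA.comp_fst.mul hwB.comp_snd
    rw [lintegral_add_left' hm, lintegral_prod_mul hwA hwB,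
      lintegral_prod_mul hwB hwA, hiA, hiB, ENNReal.ofReal_mul two_pos.le,
      ENNReal.ofReal_pow hN.le, ENNReal.ofReal_ofNat]
    ring
  rw [h1]
  refine lintegral_mono fun p => ?_
  have hF : ENNReal.ofReal (((1 + ‖p.1‖ ^ 2) * (1 + ‖p.2‖ ^ 2)) ^ (-α)) = w p.1 * w p.2 := by
    rw [hw, Real.mul_rpow (by positivity) (by positivity), ENNReal.ofReal_mul (by positivity)]
  rw [hF]
  have hAB : ∀ x, x ∈ A → x ∉ B := fun x hx hx' => by
    have := hgA x hx; rw [hgB x hx'] at this; exact one_ne_zero this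
  by_cases h1A : p.1 ∈ A
  · have h1B := hAB _ h1A
    by_cases h2B : p.2 ∈ B
    · simp [h1A, h1B, h2B, hgA _ h1A, hgB _ h2B]
    · simp [h1B, h2B]
  · by_cases h1B : p.1 ∈ B
    · by_cases h2A : p.2 ∈ A
      · simp [h1A, h1B, h2A, hgA _ h2A, hgB _ h1B]
      · simp [h1A, h2A]
    · simp [h1A, h1B]

/-- The constant of the rotation argument is at most the one in the isoperimetric inequality. -/
theorem isoperimetric_constant_le {n : ℕ} (hn : 1 ≤ n) {b J : ℝ} (hb : 1 / 2 ≤ b)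
    (hJb : (b + n / 2) * J ^ 2 ≤ 8 * gammaQuotSq b) :
    Real.pi / 2 * J * linearMoment n b * cauchyNorm n (b + n / 2) *
      (cauchyD n (b + n + 1 / 2) * √(2 * (b + n / 2)) / √Real.pi) ≤
    2 * cauchyNorm n (b + n + 1 / 2) ^ 2 := by
  have hb0 : 0 < b := by linarith
  have hπ := Real.pi_pos
  have g1 : 0 < Real.Gamma b := Real.Gamma_pos_of_pos hb0
  have g2 : 0 < Real.Gamma (b + 1 / 2) := Real.Gamma_pos_of_pos (by positivity)
  have g3 : 0 < Real.Gamma (b + (n : ℝ) / 2) := Real.Gamma_pos_of_pos (by positivity)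
  have g4 : 0 < Real.Gamma (b + (n : ℝ) + 1 / 2) := Real.Gamma_pos_of_pos (by positivity)
  have g5 : 0 < Real.Gamma (b + (n : ℝ) / 2 + 1 / 2) := Real.Gamma_pos_of_pos (by positivity)
  -- The square root of the hypothesis on `J`; every other Gamma factor cancels.
  have hkey : J * √(2 * (b + n / 2)) * Real.Gamma b ≤ 4 * Real.Gamma (b + 1 / 2) := by
    apply le_of_sq_le_sq _ (by positivity)
    rw [mul_pow, mul_pow, Real.sq_sqrt (by positivity)]
    unfold gammaQuotSq at hJb
    rw [div_pow, mul_div_assoc', le_div_iff₀ (by positivity)] at hJb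
    linarith
  rw [cauchyNorm_eq hn (by linarith), cauchyNorm_eq hn (by linarith), cauchyD, linearMoment,
    show b + (n : ℝ) / 2 - n / 2 = b by ring, show b + (n : ℝ) + 1 / 2 - n = b + 1 / 2 by ring,
    show b + (n : ℝ) + 1 / 2 - n / 2 = b + n / 2 + 1 / 2 by ring]
  set P := Real.pi ^ ((n : ℝ) / 2) with hP
  have hP0 : 0 < P := by positivity
  have hP1 : Real.pi ^ (((n : ℝ) - 1) / 2) = P / √Real.pi := by
    rw [hP, Real.sqrt_eq_rpow, ← Real.rpow_sub hπ]
    congr 1; ring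
  have hs : 0 < √Real.pi := Real.sqrt_pos.2 hπ
  have hs2 : √Real.pi ^ 2 = Real.pi := Real.sq_sqrt hπ.le
  rw [hP1]
  set G := Real.Gamma (b + (n : ℝ) / 2 + 1 / 2)
  set H := Real.Gamma (b + (n : ℝ) + 1 / 2)
  set Q := √(2 * (b + (n : ℝ) / 2))
  have e : Real.pi / 2 * J * (P / √Real.pi * Real.Gamma (b + n / 2) / H) *
      (P * Real.Gamma b / Real.Gamma (b + n / 2)) *
      (G ^ 2 / (Real.Gamma (b + 1 / 2) * H) * Q / √Real.pi) =
      (J * Q * Real.Gamma b) * (P ^ 2 * G ^ 2 / (2 * H ^ 2 * Real.Gamma (b + 1 / 2))) := by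
    rw [show Real.pi / 2 * J * (P / √Real.pi * Real.Gamma (b + n / 2) / H) *
      (P * Real.Gamma b / Real.Gamma (b + n / 2)) *
      (G ^ 2 / (Real.Gamma (b + 1 / 2) * H) * Q / √Real.pi) =
      Real.pi / √Real.pi ^ 2 * (J * (P * Real.Gamma (b + n / 2) / H) *
      (P * Real.Gamma b / Real.Gamma (b + n / 2)) *
      (G ^ 2 / (Real.Gamma (b + 1 / 2) * H) * Q) / 2) by field_simp, hs2, div_self hπ.ne', one_mul]
    field_simp
  rw [e]
  calc _ ≤ (4 * Real.Gamma (b + 1 / 2)) *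
        (P ^ 2 * G ^ 2 / (2 * H ^ 2 * Real.Gamma (b + 1 / 2))) := by gcongr
    _ = _ := by field_simp; ring

/-- The isoperimetric inequality at scale `ε`, with a slightly smaller neighbourhood width. -/
theorem cauchy_isoperimetric_width {n : ℕ} (hn : 1 ≤ n) {b c : ℝ} (hb : 1 / 2 ≤ b)
    (hc : c = cauchyD n (b + n + 1 / 2) * √(2 * (b + n / 2)) / √Real.pi)
    {A : Set (EuclideanSpace ℝ (Fin n))} (hA : MeasurableSet A) {ε δ : ℝ} (hδ : 0 < δ)
    (hε : 2 * δ < ε) :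
    ENNReal.ofReal (c * (ε - 2 * δ)) * (cauchyMeasure n (b + n + 1 / 2) A *
        cauchyMeasure n (b + n + 1 / 2) (Metric.thickening ε A)ᶜ) ≤
      cauchyMeasure n (b + n / 2) (Metric.thickening ε A \ A) := by
  rcases A.eq_empty_or_nonempty with rfl | hne
  · simp
  have hb0 : 0 < b := by linarith
  have hα : (n : ℝ) / 2 < b + n + 1 / 2 := by
    have : (0 : ℝ) ≤ n := by positivity
    linarith
  have hβ : (n : ℝ) / 2 < b + n / 2 := by linarith
  have hw : 0 < ε - 2 * δ := by linarith
  set N := cauchyNorm n (b + n + 1 / 2) with hN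
  set N' := cauchyNorm n (b + n / 2) with hN'
  have hN0 : 0 < N := cauchyNorm_pos hn hα
  have hN0' : 0 < N' := cauchyNorm_pos hn hβ
  have hc0 : 0 ≤ c := by
    have g2 : 0 < Real.Gamma (b + (n : ℝ) + 1 / 2 - n) := Real.Gamma_pos_of_pos (by linarith)
    have g4 : 0 < Real.Gamma (b + (n : ℝ) + 1 / 2) := Real.Gamma_pos_of_pos (by positivity)
    rw [hc, cauchyD]; positivity
  obtain ⟨J, hJ, hJb, hK⟩ := exists_fibre_constant hn hb
  have hcon := isoperimetric_constant_le hn hb hJb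
  rw [← hc, ← hN, ← hN'] at hcon
  have hlm : 0 ≤ linearMoment n b := by
    have g3 : 0 < Real.Gamma (b + (n : ℝ) / 2) := Real.Gamma_pos_of_pos (by positivity)
    have g4 : 0 < Real.Gamma (b + (n : ℝ) + 1 / 2) := Real.Gamma_pos_of_pos (by positivity)
    unfold linearMoment; positivity
  set C := Real.pi / 2 * J * linearMoment n b with hC
  have hC0 : 0 ≤ C := by positivity
  obtain ⟨g, hg, hg0, hg1, hgA, hgB, hgL⟩ := exists_contDiff_separation hne hδ hε
  have hthick : MeasurableSet (Metric.thickening ε A) := Metric.isOpen_thickening.measurableSet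
  have hlow := le_lintegral_oscillation hn hα hA hthick.compl hgA hgB
  have hup := lintegral_oscillation_le
    (F := fun p : EuclideanSpace ℝ (Fin n) × EuclideanSpace ℝ (Fin n) =>
      ENNReal.ofReal (((1 + ‖p.1‖ ^ 2) * (1 + ‖p.2‖ ^ 2)) ^ (-(b + n + 1 / 2)))) (by fun_prop)
    (w := fun z => ENNReal.ofReal (C * (1 + ‖z‖ ^ 2) ^ (-(b + n / 2)))) hK hg
  -- Points of `A` are minima of `g` and points off the thickening are maxima, so the gradient lives
  -- on the thickening minus `A` itself, whether or not `A` is closed.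
  have hD : ∀ x ∉ Metric.thickening ε A \ A, fderiv ℝ g x = 0 := by
    intro x hx
    rw [Set.mem_sdiff, not_and, not_not] at hx
    by_cases hxt : x ∈ Metric.thickening ε A
    · apply IsLocalMin.fderiv_eq_zero
      exact Eventually.of_forall fun y => by rw [hgA x (hx hxt)]; exact hg0 y
    · apply IsLocalMax.fderiv_eq_zero
      exact Eventually.of_forall fun y => by rw [hgB x hxt]; exact hg1 y
  have hgrad : ∫⁻ z, ‖fderiv ℝ g z‖ₑ * ENNReal.ofReal (C * (1 + ‖z‖ ^ 2) ^ (-(b + n / 2))) ≤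
      ENNReal.ofReal (C * N' / (ε - 2 * δ)) *
        cauchyMeasure n (b + n / 2) (Metric.thickening ε A \ A) := by
    have hms := hthick.diff hA
    calc _ ≤ ∫⁻ z, (Metric.thickening ε A \ A).indicator (fun z =>
          ENNReal.ofReal (C / (ε - 2 * δ)) * ENNReal.ofReal ((1 + ‖z‖ ^ 2) ^ (-(b + n / 2)))) z := by
          refine lintegral_mono fun z => ?_
          by_cases hz : z ∈ Metric.thickening ε A \ A
          · rw [Set.indicator_of_mem hz, ← ofReal_norm, ← ENNReal.ofReal_mul (norm_nonneg _),
              ← ENNReal.ofReal_mul (by positivity)]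
            apply ENNReal.ofReal_le_ofReal
            calc _ ≤ 1 / (ε - 2 * δ) * (C * (1 + ‖z‖ ^ 2) ^ (-(b + (n : ℝ) / 2))) := by
                  gcongr; exact hgL z
              _ = _ := by ring
          · rw [hD z hz, ← ofReal_norm, norm_zero, ENNReal.ofReal_zero, zero_mul]
            exact zero_le
      _ = ENNReal.ofReal (C / (ε - 2 * δ)) * (ENNReal.ofReal N' *
          cauchyMeasure n (b + n / 2) (Metric.thickening ε A \ A)) := by
          rw [lintegral_indicator hms, lintegral_const_mul _ (by fun_prop),
            setLIntegral_cauchy_weight hn hβ hms]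
      _ = _ := by
          rw [← mul_assoc, ← ENNReal.ofReal_mul (by positivity)]
          congr 2; ring
  have h := hlow.trans (hup.trans hgrad)
  rw [← hN] at h
  set X := cauchyMeasure n (b + n + 1 / 2) A *
        cauchyMeasure n (b + n + 1 / 2) (Metric.thickening ε A)ᶜ
  set Y := cauchyMeasure n (b + n / 2) (Metric.thickening ε A \ A)
  have hN2 : ENNReal.ofReal (2 * N ^ 2) ≠ 0 := by
    rw [Ne, ENNReal.ofReal_eq_zero, not_le]; positivity
  apply (ENNReal.mul_le_mul_iff_right hN2 ENNReal.ofReal_ne_top).1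
  calc ENNReal.ofReal (2 * N ^ 2) * (ENNReal.ofReal (c * (ε - 2 * δ)) * X)
      = ENNReal.ofReal (c * (ε - 2 * δ)) * (ENNReal.ofReal (2 * N ^ 2) * X) := by ring
    _ ≤ ENNReal.ofReal (c * (ε - 2 * δ)) * (ENNReal.ofReal (C * N' / (ε - 2 * δ)) * Y) := by gcongr
    _ = ENNReal.ofReal (C * N' * c) * Y := by
        rw [← mul_assoc, ← ENNReal.ofReal_mul (by positivity)]
        congr 2; field_simp
    _ ≤ ENNReal.ofReal (2 * N ^ 2) * Y := by gcongr

theorem cauchy_isoperimetric_thickening {n : ℕ} (hn : 1 ≤ n) {b c : ℝ} (hb : 1 / 2 ≤ b)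
    (hc : c = cauchyD n (b + n + 1 / 2) * √(2 * (b + n / 2)) / √Real.pi)
    {A : Set (EuclideanSpace ℝ (Fin n))} (hA : MeasurableSet A) {ε : ℝ} (hε : 0 < ε) :
    ENNReal.ofReal c * (cauchyMeasure n (b + n + 1 / 2) A *
        cauchyMeasure n (b + n + 1 / 2) (Metric.thickening ε A)ᶜ) ≤
      cauchyMeasure n (b + n / 2) (Metric.thickening ε A \ A) / ENNReal.ofReal ε := by
  have hα : (n : ℝ) / 2 < b + n + 1 / 2 := by
    have : (0 : ℝ) ≤ n := by positivity
    linarith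
  have := isProbabilityMeasure_cauchyMeasure n _ hα
  have hε0 : ENNReal.ofReal ε ≠ 0 := by simpa using hε
  rw [ENNReal.le_div_iff_mul_le (Or.inl hε0) (Or.inl ENNReal.ofReal_ne_top),
    mul_right_comm, ← ENNReal.ofReal_mul' hε.le]
  have hlim : Tendsto (fun δ : ℝ => ENNReal.ofReal (c * (ε - 2 * δ)) *
      (cauchyMeasure n (b + n + 1 / 2) A *
        cauchyMeasure n (b + n + 1 / 2) (Metric.thickening ε A)ᶜ)) (𝓝[>] 0)
      (𝓝 (ENNReal.ofReal (c * (ε - 2 * 0)) * (cauchyMeasure n (b + n + 1 / 2) A *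
        cauchyMeasure n (b + n + 1 / 2) (Metric.thickening ε A)ᶜ))) := by
    refine ENNReal.Tendsto.mul_const ?_
      (Or.inr (ENNReal.mul_ne_top (measure_ne_top _ _) (measure_ne_top _ _)))
    have hcont : Continuous fun δ : ℝ => ENNReal.ofReal (c * (ε - 2 * δ)) :=
      ENNReal.continuous_ofReal.comp (by fun_prop)
    exact (hcont.tendsto 0).mono_left nhdsWithin_le_nhds
  rw [mul_zero, sub_zero] at hlim
  refine le_of_tendsto hlim ?_
  filter_upwards [Ioo_mem_nhdsGT (show (0 : ℝ) < ε / 2 by positivity)] with δ hδ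
  exact cauchy_isoperimetric_width hn hb hc hA hδ.1 (by linarith [hδ.2])

/-- If the closure of `A` adds no mass, thickenings shrink to `A` in measure and the bound at scale
`ε` passes to the limit. Otherwise the numerator stays above a positive constant and the perimeter
is infinite. -/
theorem cauchy_isoperimetric {n : ℕ} (hn : 1 ≤ n) {b c : ℝ} (hb : 1 / 2 ≤ b)
    (hc : c = cauchyD n (b + n + 1 / 2) * √(2 * (b + n / 2)) / √Real.pi)
    {A : Set (EuclideanSpace ℝ (Fin n))} (hA : MeasurableSet A) :
    ENNReal.ofReal c * (cauchyMeasure n (b + n + 1 / 2) A *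
        (1 - cauchyMeasure n (b + n + 1 / 2) A)) ≤
      outerPerimeter (cauchyMeasure n (b + n / 2)) A := by
  have hα : (n : ℝ) / 2 < b + n + 1 / 2 := by
    have : (0 : ℝ) ≤ n := by positivity
    linarith
  have hβ : (n : ℝ) / 2 < b + n / 2 := by linarith
  have := isProbabilityMeasure_cauchyMeasure n _ hα
  have := isProbabilityMeasure_cauchyMeasure n _ hβ
  set μ := cauchyMeasure n (b + n + 1 / 2) with hμ
  set ν := cauchyMeasure n (b + n / 2) with hν
  have hdiff : ∀ ε : ℝ, 0 < ε → ν (Metric.thickening ε A \ A) = ν (Metric.thickening ε A) - ν A :=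
    fun ε hε => measure_sdiff (Metric.self_subset_thickening hε A) hA.nullMeasurableSet
      (measure_ne_top _ _)
  unfold outerPerimeter
  by_cases hcl : volume (closure A \ A) = 0
  · have hμcl : μ (closure A) = μ A := by
      have h0 : μ (closure A \ A) = 0 := withDensity_absolutelyContinuous _ _ hcl
      refine le_antisymm ?_ (measure_mono subset_closure)
      calc μ (closure A) ≤ μ (A ∪ (closure A \ A)) := measure_mono (by simp)
        _ ≤ μ A + μ (closure A \ A) := measure_union_le _ _
        _ = μ A := by rw [h0, add_zero]
    have ht : Tendsto (fun ε : ℝ => μ (Metric.thickening ε A)) (𝓝[>] 0) (𝓝 (μ A)) := by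
      rw [← hμcl]
      exact tendsto_measure_thickening ⟨1, one_pos, measure_ne_top _ _⟩
    have ht2 : Tendsto (fun ε : ℝ => ENNReal.ofReal c * (μ A * μ (Metric.thickening ε A)ᶜ)) (𝓝[>] 0)
        (𝓝 (ENNReal.ofReal c * (μ A * (1 - μ A)))) := by
      refine ENNReal.Tendsto.const_mul (ENNReal.Tendsto.const_mul ?_
        (Or.inr (measure_ne_top _ _))) (Or.inr ENNReal.ofReal_ne_top)
      have : ∀ ε : ℝ, μ (Metric.thickening ε A)ᶜ = 1 - μ (Metric.thickening ε A) := fun ε =>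
        prob_compl_eq_one_sub Metric.isOpen_thickening.measurableSet
      simp only [this]
      exact ENNReal.Tendsto.sub tendsto_const_nhds ht (Or.inl ENNReal.one_ne_top)
    rw [← ht2.liminf_eq]
    refine liminf_le_liminf ?_
    filter_upwards [self_mem_nhdsWithin] with ε hε
    rw [← hdiff ε hε]
    exact cauchy_isoperimetric_thickening hn hb hc hA hε
  · have hpos : ν (closure A \ A) ≠ 0 := fun h0 =>
      hcl (volume_absolutelyContinuous_cauchyMeasure hn hβ h0)
    have ht : Tendsto (fun ε : ℝ => ν (closure A \ A) / ENNReal.ofReal ε) (𝓝[>] 0) (𝓝 ⊤) := by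
      have h1 : Tendsto (fun ε : ℝ => ENNReal.ofReal ε) (𝓝[>] 0) (𝓝 0) := by
        rw [← ENNReal.ofReal_zero]
        exact (ENNReal.continuous_ofReal.tendsto 0).mono_left nhdsWithin_le_nhds
      have h2 := ENNReal.Tendsto.const_div (a := ν (closure A \ A)) h1 (Or.inl ENNReal.zero_ne_top)
      rwa [ENNReal.div_zero hpos] at h2
    refine le_top.trans ?_
    rw [← ht.liminf_eq]
    refine liminf_le_liminf ?_
    filter_upwards [self_mem_nhdsWithin] with ε hε
    rw [← hdiff ε hε]
    refine ENNReal.div_le_div_right (measure_mono ?_) _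
    exact Set.sdiff_subset_sdiff_left (Metric.closure_subset_thickening hε A)

end

theorem corollary2p4 (n : ℕ) (hn : 1 ≤ n) (β βs c : ℝ) (hβ : ((n : ℝ) + 1) / 2 ≤ β)
    (hβs : βs = β + ((n : ℝ) + 1) / 2)
    (hc : c = cauchyD n βs * √(2 * β) / √Real.pi) :
    (∀ A : Set (EuclideanSpace ℝ (Fin n)), MeasurableSet A →
      ENNReal.ofReal
          (c * (cauchyMeasure n βs).real A * (1 - (cauchyMeasure n βs).real A)) ≤
        outerPerimeter (cauchyMeasure n β) A) ∧
    ((n : ℝ) ^ 2 ≤ β → √β / √(2 * Real.pi) ≤ c) := by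
  have hn0 : (0 : ℝ) ≤ n := by positivity
  have hβ0 : 0 ≤ β := by linarith
  constructor
  · intro A hA
    obtain ⟨b, rfl⟩ : ∃ b, β = b + n / 2 := ⟨β - n / 2, by ring⟩
    have hα : βs = b + n + 1 / 2 := by rw [hβs]; ring
    subst hα
    have hb : 1 / 2 ≤ b := by linarith
    have hα : (n : ℝ) / 2 < b + n + 1 / 2 := by linarith
    have := isProbabilityMeasure_cauchyMeasure n _ hα
    refine le_trans (le_of_eq ?_) (cauchy_isoperimetric hn hb hc hA)
    rw [mul_assoc, ENNReal.ofReal_mul' (mul_nonneg measureReal_nonneg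
      (sub_nonneg.2 measureReal_le_one)), ENNReal.ofReal_mul measureReal_nonneg,
      ENNReal.ofReal_sub _ measureReal_nonneg, ofReal_measureReal, ENNReal.ofReal_one]
  · intro h
    have hd := half_le_cauchyD hn h
    rw [← hβs] at hd
    have hπ : 0 < √Real.pi := Real.sqrt_pos.2 Real.pi_pos
    have h2 : √2 ^ 2 = 2 := Real.sq_sqrt (by norm_num)
    rw [hc, Real.sqrt_mul (by norm_num), Real.sqrt_mul (by norm_num)]
    calc √β / (√2 * √Real.pi) = 1 / 2 * (√2 * √β) / √Real.pi := by
          field_simp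
          rw [h2]
      _ ≤ _ := by gcongr
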